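/- Let $S$ be a regular local ring, $f\in S$ a nonzero nonunit, $n\ge 1$ an integer, $R=S/(f)$ and $R^\#=S[y]/(f+y^n)$; both $R$ and $R^\#$ are local rings, and $R=R^\#/(y)$. For a local ring $Q$ let $\operatorname{MCM}(Q)$ be the full subcategory of $Q$-modules consisting of the maximal Cohen--Macaulay modules, that is, the finitely generated modules $N$ with $N=0$ or $\operatorname{depth} N=\dim Q$. Suppose that $R$ has finite Cohen--Macaulay representation type with representation generator $M$, i.e. $M$ is an $R$-module such that $\operatorname{MCM}(R)=\operatorname{add} M$, the class of modules isomorphic to direct summands of finite direct sums of copies of $M$. View $M$ as an $R^\#$-module via $R^\#\to R$, and let $\tilde M=\Omega_{R^\#}(M)$ be any first syzygy, i.e. there is an exact sequence $0\to\tilde M\to P\to M\to 0$ of $R^\#$-modules with $P$ finitely generated projective. Let $\Lambda=\operatorname{End}_{R^\#}(\tilde M)$, acting on $\tilde M$ from the right, so that $\operatorname{Hom}_{R^\#}(\tilde M,N)$ is a left $\Lambda$-module for each $R^\#$-module $N$. A finitely generated left $\Lambda$-module $X$ is called Gorenstein projective if there is an exact sequence of projective left $\Lambda$-modules $\mathbb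 P_\bullet=\cdots\to P_1\xrightarrow{d_1}P_0\xrightarrow{d_0}P_{-1}\to\cdots$ such that $\operatorname{Hom}_\Lambda(\mathbb P_\bullet,\Lambda)$ is exact and $X\cong\operatorname{im} d_0$; let $\operatorname{GP}(\Lambda)$ be the full subcategory of the category of left $\Lambda$-modules consisting of these modules. Then the functor $F=\operatorname{Hom}_{R^\#}(\tilde M,-)$ sends $\operatorname{MCM}(R^\#)$ into $\operatorname{GP}(\Lambda)$ and induces an equivalence of categories $\operatorname{MCM}(R^\#)\to\operatorname{GP}(\Lambda)$. In particular, a left $\Lambda$-module $X$ lies in $\operatorname{GP}(\Lambda)$ if and only if $X\cong\operatorname{Hom}_{R^\#}(\tilde M,N)$ for some $N\in\operatorname{MCM}(R^\#)$. -/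

import Mathlib

open CategoryTheory

universe u

/-! ### Generalities on modules -/

section Generalities

/-- The finitely generated maximal Cohen-Macaulay modules over a local ring `R`: finitely generated
modules `N` that are zero or admit an `N`-regular sequence in the maximal ideal whose length is
the Krull dimension of `R` (i.e. `depth N = dim R`). -/
def MCM (R : Type u) [CommRing R] [IsLocalRing R] : ObjectProperty (ModuleCat.{u} R) := fun N =>
  Module.Finite R N ∧
    (Subsingleton N ∨
      ∃ rs : List R, (∀ r ∈ rs, r ∈ IsLocalRing.maximalIdeal R) ∧
        RingTheory.Sequence.IsRegular N rs ∧ (rs.length : WithBot ℕ∞) = ringKrullDim R)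

/-- `add M`: the modules isomorphic to a direct summand of a finite direct sum of copies of `M`. -/
def addClosure {R : Type u} [Ring R] (M : ModuleCat.{u} R) : ObjectProperty (ModuleCat.{u} R) :=
  fun N => ∃ (k : ℕ) (N' : ModuleCat.{u} R), Nonempty ((N × N') ≃ₗ[R] (Fin k → M))

/-- `M` is a representation generator for the MCM `R`-modules: `add M = MCM R`. -/
def IsRepresentationGenerator {R : Type u} [CommRing R] [IsLocalRing R]
    (M : ModuleCat.{u} R) : Prop :=
  addClosure M = MCM R

/-- `Z` is a first syzygy of `X`: there is a short exact sequence `0 → Z → P → X → 0` with `P` a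
finitely generated projective module. -/
def IsFirstSyzygy {R : Type u} [Ring R] (X Z : ModuleCat.{u} R) : Prop :=
  ∃ (P : ModuleCat.{u} R) (i : Z →ₗ[R] P) (p : P →ₗ[R] X),
    Module.Finite R P ∧ Module.Projective R P ∧
      Function.Injective i ∧ Function.Exact i p ∧ Function.Surjective p

/-- A complete resolution of the left `A`-module `X`, with `d i : P (i + 1) → P i`: a doubly
infinite exact sequence of projective `A`-modules that stays exact under `Hom_A(-, A)`, together
with an isomorphism of `X` with the image of one of the differentials. -/
structure CompleteResolution (A : Type u) [Ring A] (X : ModuleCat.{u} A) where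
  /-- the modules of the sequence -/
  P : ℤ → ModuleCat.{u} A
  /-- the differentials -/
  d : ∀ i : ℤ, P (i + 1) →ₗ[A] P i
  projective : ∀ i, Module.Projective A (P i)
  exact : ∀ i, Function.Exact (d (i + 1)) (d i)
  exact_hom : ∀ i, Function.Exact
    (fun φ : P i →ₗ[A] A => φ ∘ₗ d i)
    (fun φ : P (i + 1) →ₗ[A] A => φ ∘ₗ d (i + 1))
  /-- the isomorphism of `X` with an image -/
  iso : X ≃ₗ[A] LinearMap.range (d 0)

/-- The category `GP(A)` of Gorenstein projective (totally reflexive) modules, as a property of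
objects: the finitely generated left `A`-modules that admit a complete resolution. -/
def GP (A : Type u) [Ring A] : ObjectProperty (ModuleCat.{u} A) := fun X =>
  Module.Finite A X ∧ Nonempty (CompleteResolution A X)

end Generalities

/-! ### The hypersurface and its branched cover -/

section Hypersurface

variable {S : Type u} [CommRing S] [IsLocalRing S]

/-- The hypersurface ring `R = S/(f)`, for `f` a nonunit of the local ring `S`. -/
abbrev Hypersurface (f : IsLocalRing.maximalIdeal S) : Type u := S ⧸ Ideal.span {(f : S)}

/-- The `n`-fold branched cover `R^# = S[y]/(f + y^n)`. -/
abbrev BranchedCover (f : IsLocalRing.maximalIdeal S) (n : ℕ) : Type u :=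
  AdjoinRoot (Polynomial.C (f : S) + Polynomial.X ^ n)

instance Hypersurface.instIsLocalRing (f : IsLocalRing.maximalIdeal S) :
    IsLocalRing (Hypersurface f) := by
  have : Nontrivial (Hypersurface f) := by
    refine Ideal.Quotient.nontrivial_iff.2 fun h => ?_
    exact (IsLocalRing.mem_maximalIdeal _).1 f.2 (Ideal.span_singleton_eq_top.1 h)
  exact IsLocalRing.of_surjective' _ Ideal.Quotient.mk_surjective

/-- The surjection `R^# → R^#/(y) = R`, the identity on `S` and sending `y` to `0`. -/
noncomputable def BranchedCover.toHypersurface (f : IsLocalRing.maximalIdeal S) (n : ℕ) [NeZero n] :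
    BranchedCover f n →+* Hypersurface f :=
  AdjoinRoot.lift (Ideal.Quotient.mk (Ideal.span {(f : S)})) 0 (by
    simp [Polynomial.eval₂_add, NeZero.ne n])

instance BranchedCover.instIsLocalRing (f : IsLocalRing.maximalIdeal S) (n : ℕ) [NeZero n] :
    IsLocalRing (BranchedCover f n) := by
  have hn : n ≠ 0 := NeZero.ne n
  have hmonic : (Polynomial.C (f : S) + Polynomial.X ^ n).Monic := by
    rw [add_comm]; exact Polynomial.monic_X_pow_add_C _ hn
  have : Module.Finite S (BranchedCover f n) := hmonic.finite_adjoinRoot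
  have : IsLocalHom (toHypersurface f n) := by
    refine ⟨fun a ha => ?_⟩
    by_contra hna
    obtain ⟨I, hI, haI⟩ := exists_max_ideal_of_mem_nonunits hna
    have hcomap : I.comap (algebraMap S (BranchedCover f n)) = IsLocalRing.maximalIdeal S :=
      IsLocalRing.eq_maximalIdeal (Ideal.isMaximal_comap_of_isIntegral_of_isMaximal I)
    have hf : AdjoinRoot.of _ (f : S) ∈ I := by
      have h : (f : S) ∈ I.comap (algebraMap S (BranchedCover f n)) := by
        rw [hcomap]; exact f.2
      exact h
    have hrel : AdjoinRoot.of (Polynomial.C (f : S) + Polynomial.X ^ n) (f : S) +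
        AdjoinRoot.root (Polynomial.C (f : S) + Polynomial.X ^ n) ^ n = 0 := by
      have h := AdjoinRoot.mk_self (f := Polynomial.C (f : S) + Polynomial.X ^ n)
      rwa [map_add, map_pow, AdjoinRoot.mk_C, AdjoinRoot.mk_X] at h
    have hy : AdjoinRoot.root (Polynomial.C (f : S) + Polynomial.X ^ n) ∈ I := by
      refine hI.isPrime.mem_of_pow_mem n ?_
      rw [← neg_eq_of_add_eq_zero_right hrel]
      exact I.neg_mem hf
    have hker : ∀ x : BranchedCover f n, toHypersurface f n x = 0 → x ∈ I := by
      intro x hx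
      obtain ⟨p, rfl⟩ := AdjoinRoot.mk_surjective x
      have h0 : p.coeff 0 ∈ Ideal.span {(f : S)} := by
        rw [← Ideal.Quotient.eq_zero_iff_mem]
        simpa [toHypersurface, AdjoinRoot.lift_mk, Polynomial.eval₂_at_zero] using hx
      obtain ⟨c, hc⟩ := Ideal.mem_span_singleton'.1 h0
      rw [← Polynomial.divX_mul_X_add p, map_add, map_mul, AdjoinRoot.mk_X, AdjoinRoot.mk_C, ← hc,
        map_mul]
      exact I.add_mem (I.mul_mem_left _ hy) (I.mul_mem_left _ hf)
    obtain ⟨b, hb⟩ := ha.exists_right_inv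
    have hsurj : Function.Surjective (toHypersurface f n) := by
      intro z
      obtain ⟨s, rfl⟩ := Ideal.Quotient.mk_surjective z
      exact ⟨AdjoinRoot.of _ s, by simp [toHypersurface]⟩
    obtain ⟨b, rfl⟩ := hsurj b
    have h1 : a * b - 1 ∈ I := hker _ (by rw [map_sub, map_mul, hb, map_one, sub_self])
    exact hI.ne_top ((Ideal.eq_top_iff_one I).2 (by
      have := I.sub_mem (I.mul_mem_right b haI) h1
      simpa using this))
  exact RingHom.domain_isLocalRing (toHypersurface f n)

end Hypersurface

/-- The ring `Λ = End_R(M)` acting on the left module `M` from the right, so that products are read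
from left to right. As multiplication in Mathlib's `End M` is composition of functions, `Λ` is its
opposite ring. -/
abbrev RightEnd {R : Type u} [Ring R] (M : ModuleCat.{u} R) : Type u := (End M)ᵐᵒᵖ

/-- The functor `Hom_R(M, -)` from left `R`-modules to left `Λ`-modules, `Λ = End_R(M)` acting by
precomposition. -/
abbrev homFunctor {R : Type u} [Ring R] (M : ModuleCat.{u} R) :
    ModuleCat.{u} R ⥤ ModuleCat.{u} (RightEnd M) :=
  preadditiveCoyonedaObj M

/-! ### Regular local rings: regular parameters and the domain property. -/

section RegularLocalRings

open IsLocalRing Ideal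

/-! Write A for the branched cover, y for the class of the variable, and k for the residue field of
the ring in question. Since A is finite free over the regular ring S, an A-module is maximal
Cohen-Macaulay exactly when it is finitely generated and S-free (`mcm_iff_free`). Since A is
Frobenius over S, through the coefficient of y^(n-1), MCM modules embed in free modules with MCM
cokernel (`exists_mcm_quotient`) and have no extensions by free modules (`exists_extension`).

The heart is an approximation of an MCM module X by `add Mt`. For a free cover π : F → X let K =
π⁻¹(yX). It is a syzygy of X/yX, which is MCM over R because y is X-regular, and so lies in `add M`;
by a Schanuel argument K lies in `add Mt`, as A itself is a summand of Mt
(`exists_syzygy_apply_eq_one`, `isAddRetract_approx`). Dividing π by y gives an exact sequence 0 →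
ker π → K → X → 0. It remains exact under Hom(Mt, -) and Hom(-, Mt), because y kills M, whence yP ⊆
Mt (`exists_lift_approx`, `exists_extend_approx`). Splicing such sequences in both directions gives
a complete resolution of Hom(Mt, X) (`gp_homFunctor`). Full faithfulness comes from A being a
summand of Mt.

For essential surjectivity let e ∈ Λ be the idempotent projecting Mt onto that summand. For P
projective over Λ, eP is a retract of a direct sum of copies of Mt, hence S-flat. In a complete
resolution every cycle embeds in the next projective, so a maximal regular sequence of S remains
regular on e applied to the cycles (`IsWeaklyRegular.of_shortExact_family`), and eX is MCM. Finally
X ≅ Hom(Mt, eX), because X is the kernel of a map of projectives and the analogous map is an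
isomorphism for projectives (`toHomCorner_bijective`). -/

lemma IsRegularLocalRing.exists_finset_span_of_notMem_sq {S : Type*} [CommRing S]
    [IsRegularLocalRing S] {x : S} (hx : x ∈ maximalIdeal S) (hx2 : x ∉ maximalIdeal S ^ 2) :
    ∃ s : Set S, s.Finite ∧ x ∈ s ∧ s.ncard ≤ (maximalIdeal S).spanFinrank ∧
      span s = maximalIdeal S := by
  classical
  let V := CotangentSpace S
  let x0 : maximalIdeal S := ⟨x, hx⟩
  have hx0 : (maximalIdeal S).toCotangent x0 ≠ 0 := by
    rw [Ne, Ideal.toCotangent_eq_zero]; exact hx2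
  have hli : LinearIndepOn (ResidueField S) id {((maximalIdeal S).toCotangent x0 : V)} :=
    LinearIndepOn.singleton (by simpa using hx0)
  let b := hli.extend (Set.subset_univ _)
  let B := Module.Basis.extend hli
  have hb : ((maximalIdeal S).toCotangent x0 : V) ∈ b :=
    hli.subset_extend (Set.subset_univ _) (Set.mem_singleton _)
  have hbfin : b.Finite := Module.Finite.finite_basis B
  have hcard : b.ncard = (maximalIdeal S).spanFinrank := by
    rw [spanFinrank_maximalIdeal_eq_finrank_cotangentSpace, Module.finrank_eq_nat_card_basis B]
    rfl
  have hspan : Submodule.span (ResidueField S) b = ⊤ := by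
    simpa [b, B] using B.span_eq
  -- A set-theoretic section of the cotangent map that returns x on the class of x. By Nakayama the
  -- lifts of a basis generate the maximal ideal.
  let g : V → maximalIdeal S := fun v =>
    if v = (maximalIdeal S).toCotangent x0 then x0
    else Function.surjInv (maximalIdeal S).toCotangent_surjective v
  have hg : ∀ v, (maximalIdeal S).toCotangent (g v) = v := by
    intro v
    by_cases h : v = (maximalIdeal S).toCotangent x0
    · simp [g, h]
    · simp only [g, h, if_false]
      exact Function.surjInv_eq _ _
  have hgx : g ((maximalIdeal S).toCotangent x0) = x0 := by simp [g]
  have himg : (maximalIdeal S).toCotangent '' (g '' b) = b := by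
    rw [Set.image_image]; simp [hg]
  have htop : Submodule.span S (g '' b) = ⊤ := by
    rw [← CotangentSpace.span_image_eq_top_iff, himg, hspan]
  refine ⟨Subtype.val '' (g '' b), (hbfin.image _).image _, ?_, ?_, ?_⟩
  · exact ⟨x0, ⟨_, hb, hgx⟩, rfl⟩
  · refine (Set.ncard_image_le (hbfin.image _)).trans ?_
    exact (Set.ncard_image_le hbfin).trans hcard.le
  · have h := congrArg (Submodule.map (maximalIdeal S).subtype) htop
    rw [Submodule.map_span, Submodule.map_top, Submodule.range_subtype] at h
    exact h

lemma ringKrullDim_le_quotient_span_singleton_succ {S : Type*} [CommRing S]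
    [IsNoetherianRing S] [IsLocalRing S] {x : S} (hx : x ∈ maximalIdeal S) :
    ringKrullDim S ≤ ringKrullDim (S ⧸ span {x}) + 1 := by
  have h := ringKrullDim_le_ringKrullDim_quotSMulTop_succ hx
  rwa [← Submodule.ideal_span_singleton_smul, smul_eq_mul, Ideal.mul_top] at h

lemma IsLocalRing.quotient_span_singleton {S : Type*} [CommRing S] [IsLocalRing S] {x : S}
    (hx : x ∈ maximalIdeal S) : IsLocalRing (S ⧸ span {x}) := by
  have : Nontrivial (S ⧸ span {x}) := Ideal.Quotient.nontrivial_iff.2 fun h =>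
    (mem_maximalIdeal _).1 hx (Ideal.span_singleton_eq_top.1 h)
  exact IsLocalRing.of_surjective' _ Ideal.Quotient.mk_surjective

/-- A regular local ring modulo a regular parameter is regular, of dimension one less. -/
lemma IsRegularLocalRing.quotient_span_singleton {S : Type*} [CommRing S]
    [IsRegularLocalRing S] {x : S} (hx : x ∈ maximalIdeal S) (hx2 : x ∉ maximalIdeal S ^ 2) {d : ℕ}
    (hd : ringKrullDim S = (d + 1 : ℕ)) :
    ∃ _ : IsLocalRing (S ⧸ span {x}), IsRegularLocalRing (S ⧸ span {x}) ∧
      ringKrullDim (S ⧸ span {x}) = d := by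
  have hloc := IsLocalRing.quotient_span_singleton hx
  obtain ⟨s, hs, hxs, hcard, hspan⟩ := IsRegularLocalRing.exists_finset_span_of_notMem_sq hx hx2
  let π := Ideal.Quotient.mk (span {x})
  have hmax : maximalIdeal (S ⧸ span {x}) = span (π '' (s \ {x})) := by
    rw [← IsLocalRing.map_maximalIdeal_of_surjective π Ideal.Quotient.mk_surjective, ← hspan,
      Ideal.map_span]
    have h0 : π x = 0 := Ideal.Quotient.eq_zero_iff_mem.2 (Ideal.mem_span_singleton_self x)
    apply le_antisymm
    · rw [Ideal.span_le]
      rintro _ ⟨z, hz, rfl⟩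
      by_cases hzx : z = x
      · subst hzx
        rw [h0]; exact Ideal.zero_mem _
      · exact Ideal.subset_span ⟨z, ⟨hz, hzx⟩, rfl⟩
    · exact Ideal.span_mono (Set.image_mono Set.sdiff_subset)
  have hd' : (maximalIdeal S).spanFinrank = d + 1 := by
    have h := IsRegularLocalRing.spanFinrank_maximalIdeal (R := S)
    rw [hd] at h
    exact_mod_cast h
  have hle : (maximalIdeal (S ⧸ span {x})).spanFinrank ≤ d := by
    rw [hmax]
    refine (Submodule.spanFinrank_span_le_ncard_of_finite ((hs.subset Set.sdiff_subset).image _)).trans ?_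
    refine (Set.ncard_image_le (hs.subset Set.sdiff_subset)).trans ?_
    have := Set.ncard_sdiff_singleton_add_one hxs (hs := hs)
    omega
  -- The dimension drops by at most one and the number of generators by at least one, so the two
  -- agree on the quotient.
  have hdim : (d : WithBot ℕ∞) ≤ ringKrullDim (S ⧸ span {x}) := by
    have h := ringKrullDim_le_quotient_span_singleton_succ hx
    rw [hd] at h
    push_cast at h
    exact ENat.WithBot.add_le_add_one_right_iff.1 h
  have hreg : IsRegularLocalRing (S ⧸ span {x}) :=
    IsRegularLocalRing.of_spanFinrank_maximalIdeal_le _ ((Nat.cast_le.2 hle).trans hdim)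
  refine ⟨hloc, hreg, le_antisymm ?_ hdim⟩
  rw [← IsRegularLocalRing.spanFinrank_maximalIdeal]
  exact_mod_cast hle

/-- Prime avoidance, with the square of the maximal ideal as a further ideal. -/
lemma IsLocalRing.exists_mem_maximalIdeal_notMem_sq {S : Type*} [CommRing S] [IsLocalRing S]
    [IsNoetherianRing S] (hS : ¬ IsField S) {T : Set (Ideal S)} (hT : T.Finite)
    (hprime : ∀ p ∈ T, p.IsPrime) (hne : ∀ p ∈ T, p ≠ maximalIdeal S) :
    ∃ x ∈ maximalIdeal S, x ∉ maximalIdeal S ^ 2 ∧ ∀ p ∈ T, x ∉ p := by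
  by_contra! hcon
  have hsub : (maximalIdeal S : Set S) ⊆ ((maximalIdeal S ^ 2 : Ideal S) : Set S) ∪
      ((maximalIdeal S ^ 2 : Ideal S) : Set S) ∪ ⋃ i ∈ (↑hT.toFinset : Set (Ideal S)), (id i : Set S) := by
    intro x hx
    by_cases h2 : x ∈ maximalIdeal S ^ 2
    · exact Or.inl (Or.inl h2)
    · obtain ⟨p, hp, hxp⟩ := hcon x hx h2
      refine Or.inr ?_
      simp only [Set.mem_iUnion]
      exact ⟨p, by simpa using hp, hxp⟩
  have hsq : ¬ maximalIdeal S ≤ maximalIdeal S ^ 2 := by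
    intro h
    apply hS
    rw [IsLocalRing.isField_iff_maximalIdeal_eq]
    refine Submodule.eq_bot_of_le_smul_of_le_jacobson_bot (maximalIdeal S) _
      (IsNoetherian.noetherian _) ?_ (IsLocalRing.jacobson_eq_maximalIdeal _ bot_ne_top).ge
    rwa [smul_eq_mul, ← pow_two]
  -- This form of prime avoidance allows two arbitrary ideals; the square of the maximal ideal fills
  -- both places.
  rcases (Ideal.subset_union_prime' (f := id) (a := maximalIdeal S ^ 2) (b := maximalIdeal S ^ 2)
    (fun p hp => hprime p (by simpa using hp))).1 hsub with h | h | ⟨p, hp, h⟩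
  · exact hsq h
  · exact hsq h
  · have hp' : p ∈ T := by simpa using hp
    exact hne p hp' ((maximalIdeal.isMaximal S).eq_of_le (hprime p hp').ne_top h).symm

lemma IsRegularLocalRing.isField_of_ringKrullDim_eq_zero {S : Type*} [CommRing S]
    [IsRegularLocalRing S] (hd : ringKrullDim S = 0) : IsField S := by
  have h := IsRegularLocalRing.spanFinrank_maximalIdeal (R := S)
  rw [hd] at h
  have h' : (maximalIdeal S).spanFinrank = 0 := by exact_mod_cast h
  rw [spanFinrank_maximalIdeal_eq_finrank_cotangentSpace] at h'
  exact finrank_cotangentSpace_eq_zero_iff.1 h'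

lemma IsRegularLocalRing.exists_ringKrullDim_eq (S : Type*) [CommRing S] [IsRegularLocalRing S] :
    ∃ d : ℕ, ringKrullDim S = d :=
  ⟨_, (IsRegularLocalRing.spanFinrank_maximalIdeal (R := S)).symm⟩

lemma IsLocalRing.not_isField_of_ringKrullDim_eq_succ {S : Type*} [CommRing S] {d : ℕ}
    (hd : ringKrullDim S = (d + 1 : ℕ)) : ¬ IsField S := fun h => by
  rw [ringKrullDim_eq_zero_of_isField h] at hd
  have : (0 : ℕ) = d + 1 := by exact_mod_cast hd
  omega

theorem IsRegularLocalRing.isDomain_of_ringKrullDim_eq (d : ℕ) : ∀ (S : Type u) [CommRing S]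
    [IsRegularLocalRing S], ringKrullDim S = d → IsDomain S := by
  induction d with
  | zero =>
    intro S _ _ hd
    exact (IsRegularLocalRing.isField_of_ringKrullDim_eq_zero (by simpa using hd)).isDomain
  | succ d ih =>
    intro S _ _ hd
    have hmin : ∀ p ∈ minimalPrimes S, p ≠ maximalIdeal S := by
      rintro p hp rfl
      have : Ring.KrullDimLE 0 S := by
        refine Ring.krullDimLE_zero_iff.2 fun I hI => ?_
        have := hp.2 ⟨hI, bot_le⟩ (le_maximalIdeal hI.ne_top)
        rw [le_antisymm (le_maximalIdeal hI.ne_top) this]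
        exact maximalIdeal.isMaximal S
      have h := Ring.krullDimLE_iff.1 this
      rw [hd] at h
      have : d + 1 ≤ 0 := by exact_mod_cast h
      omega
    obtain ⟨x, hx, hx2, hxp⟩ := IsLocalRing.exists_mem_maximalIdeal_notMem_sq
      (IsLocalRing.not_isField_of_ringKrullDim_eq_succ hd) (minimalPrimes.finite_of_isNoetherianRing S)
      (fun p hp => hp.1.1) hmin
    obtain ⟨_, _, hd'⟩ := IsRegularLocalRing.quotient_span_singleton hx hx2 hd
    have := ih (S ⧸ span {x}) hd'
    have hprime : (span {x}).IsPrime := (Ideal.Quotient.isDomain_iff_prime _).1 this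
    obtain ⟨p, hp, hpx⟩ := Ideal.exists_minimalPrimes_le (I := (⊥ : Ideal S)) (J := span {x}) bot_le
    have hpprime : p.IsPrime := hp.1.1
    have hxnp : x ∉ p := hxp p hp
    -- As x ∉ p and p ⊆ (x), primality gives p = xp, so Nakayama kills p.
    have hbot : p = ⊥ := by
      refine Submodule.eq_bot_of_le_smul_of_le_jacobson_bot (maximalIdeal S) _
        (IsNoetherian.noetherian _) ?_ (IsLocalRing.jacobson_eq_maximalIdeal _ bot_ne_top).ge
      intro z hz
      obtain ⟨c, rfl⟩ := Ideal.mem_span_singleton'.1 (hpx hz)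
      rw [mul_comm]
      exact Ideal.mul_mem_mul hx ((hpprime.mem_or_mem hz).resolve_right hxnp)
    subst hbot
    exact IsDomain.of_bot_isPrime S

/-- A regular local ring is a domain. -/
theorem IsRegularLocalRing.isDomain (S : Type u) [CommRing S] [IsRegularLocalRing S] :
    IsDomain S := by
  obtain ⟨d, hd⟩ := IsRegularLocalRing.exists_ringKrullDim_eq S
  exact IsRegularLocalRing.isDomain_of_ringKrullDim_eq d S hd

end RegularLocalRings

/-! ### Depth through Ext. -/

section Depth

open IsLocalRing Ideal RingTheory.Sequence Pointwise Abelian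

/-- The module `X` over the local ring `A` admits a weakly regular sequence of length `n` in the
maximal ideal; for `X` finitely generated, this says that `X` is zero or of depth at least `n`. -/
def DepthGE (A : Type u) [CommRing A] [IsLocalRing A] (X : Type u) [AddCommGroup X] [Module A X]
    (n : ℕ) : Prop :=
  ∃ rs : List A, rs.length = n ∧ (∀ r ∈ rs, r ∈ maximalIdeal A) ∧ IsWeaklyRegular X rs

variable {A : Type u} [CommRing A] [IsLocalRing A]

lemma DepthGE.of_linearEquiv {X Y : Type u} [AddCommGroup X] [Module A X] [AddCommGroup Y]
    [Module A Y] (e : X ≃ₗ[A] Y) {n : ℕ} (h : DepthGE A X n) : DepthGE A Y n := by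
  obtain ⟨rs, hl, hm, hr⟩ := h
  exact ⟨rs, hl, hm, (e.isWeaklyRegular_congr rs).1 hr⟩

lemma DepthGE.cons {X : Type u} [AddCommGroup X] [Module A X] {x : A} (hx : x ∈ maximalIdeal A)
    (hreg : IsSMulRegular X x) {n : ℕ} (h : DepthGE A (QuotSMulTop x X) n) :
    DepthGE A X (n + 1) := by
  obtain ⟨rs, hl, hm, hr⟩ := h
  refine ⟨x :: rs, by simp [hl], ?_, hr.cons hreg⟩
  simpa using ⟨hx, hm⟩

lemma depthGE_of_subsingleton (X : Type u) [AddCommGroup X] [Module A X] [Subsingleton X] (n : ℕ) :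
    DepthGE A X n := by
  refine ⟨List.replicate n 0, by simp, ?_, ?_⟩
  · intro r hr
    rw [List.eq_of_mem_replicate hr]
    exact Ideal.zero_mem _
  · refine ⟨fun i hi => ?_⟩
    intro x y _
    exact Subsingleton.elim (α := X ⧸ _) x y

lemma mcm_iff_depthGE {n : ℕ} (hn : ringKrullDim A = n) (N : ModuleCat.{u} A) :
    MCM A N ↔ Module.Finite A N ∧ DepthGE A N n := by
  constructor
  · rintro ⟨h, h' | ⟨rs, hm, hr, hl⟩⟩
    · exact ⟨h, depthGE_of_subsingleton _ _⟩
    · refine ⟨h, rs, ?_, hm, hr.1⟩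
      rw [hn] at hl
      exact_mod_cast hl
  · rintro ⟨h, rs, hl, hm, hr⟩
    refine ⟨h, ?_⟩
    rcases subsingleton_or_nontrivial N with hN | hN
    · exact Or.inl hN
    · exact Or.inr ⟨rs, hm, IsRegular.of_isWeaklyRegular_of_mem_maximalIdeal N hm hr, by rw [hl, hn]⟩

/-- Rees' theorem. It frees depth from the choice of a regular sequence; both sides hold for the
zero module. -/
lemma depthGE_iff_subsingleton_ext [IsNoetherianRing A] (X : ModuleCat.{u} A) [Module.Finite A X]
    (n : ℕ) : DepthGE A X n ↔
      ∀ i < n, Subsingleton (Ext (ModuleCat.of A (Shrink.{u} (A ⧸ maximalIdeal A))) X i) := by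
  rcases subsingleton_or_nontrivial X with hX | hX
  · refine iff_of_true (depthGE_of_subsingleton _ _) fun i _ => ?_
    have hz : Limits.IsZero X := ModuleCat.isZero_of_subsingleton X
    refine ⟨fun a b => ?_⟩
    rw [← Ext.comp_mk₀_id a, ← Ext.comp_mk₀_id b, hz.eq_of_src (𝟙 X) 0, Ext.mk₀_zero, Ext.comp_zero,
      Ext.comp_zero]
  · have hlt : maximalIdeal A • (⊤ : Submodule A X) < ⊤ := by
      refine lt_top_iff_ne_top.2 (Submodule.top_ne_ideal_smul_of_le_jacobson_annihilator ?_).symm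
      exact maximalIdeal_le_jacobson _
    have h := (ModuleCat.exists_isRegular_tfae (maximalIdeal A) n X hlt).out 1 3
    rw [h]
    constructor
    · rintro ⟨rs, hl, hm, hr⟩
      exact ⟨rs, hl, hm, IsRegular.of_isWeaklyRegular_of_mem_maximalIdeal X hm hr⟩
    · rintro ⟨rs, hl, hm, hr⟩
      exact ⟨rs, hl, hm, hr.1⟩

/-- The long exact sequence of 0 → X → X → X/xX → 0 squeezes Ext^i(k, X/xX) between Ext^i(k, X) and
Ext^(i+1)(k, X). Thus x need not begin the given regular sequence. -/
lemma DepthGE.quotSMulTop [IsNoetherianRing A] {X : Type u} [AddCommGroup X] [Module A X]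
    [Module.Finite A X] {n : ℕ} (h : DepthGE A X (n + 1)) {x : A} (hreg : IsSMulRegular X x) :
    DepthGE A (QuotSMulTop x X) n := by
  have h' := (depthGE_iff_subsingleton_ext (ModuleCat.of A X) _).1 h
  refine (depthGE_iff_subsingleton_ext (ModuleCat.of A (QuotSMulTop x X)) _).2 fun i hi => ?_
  have zero1 := AddCommGrpCat.isZero_of_iff_subsingleton.mpr (h' i (by omega))
  have zero2 := AddCommGrpCat.isZero_of_iff_subsingleton.mpr (h' (i + 1) (by omega))
  have hreg' : IsSMulRegular (ModuleCat.of A X) x := hreg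
  exact AddCommGrpCat.subsingleton_of_isZero <| ShortComplex.Exact.isZero_of_both_zeros
    ((Ext.covariant_sequence_exact₃' _ hreg'.smulShortComplex_shortExact) i (i + 1) rfl)
    (zero1.eq_zero_of_src _) (zero2.eq_zero_of_tgt _)

/-- The depth lemma for the kernel in a short exact sequence. -/
lemma DepthGE.of_shortExact [IsNoetherianRing A] {L P X : Type u} [AddCommGroup L] [Module A L]
    [AddCommGroup P] [Module A P] [AddCommGroup X] [Module A X] [Module.Finite A L]
    [Module.Finite A P] [Module.Finite A X] (i : L →ₗ[A] P) (p : P →ₗ[A] X)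
    (hi : Function.Injective i) (hip : Function.Exact i p) (hp : Function.Surjective p) {n : ℕ}
    (hP : DepthGE A P (n + 1)) (hX : DepthGE A X n) : DepthGE A L (n + 1) := by
  have hP' := (depthGE_iff_subsingleton_ext (ModuleCat.of A P) _).1 hP
  have hX' := (depthGE_iff_subsingleton_ext (ModuleCat.of A X) _).1 hX
  let C : ShortComplex (ModuleCat.{u} A) := ShortComplex.mk (ModuleCat.ofHom i) (ModuleCat.ofHom p)
    (by ext z; exact hip.apply_apply_eq_zero z)
  have hC : C.ShortExact :=
    { exact := (ShortComplex.ShortExact.moduleCat_exact_iff_function_exact C).2 hip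
      mono_f := (ModuleCat.mono_iff_injective _).2 hi
      epi_g := (ModuleCat.epi_iff_surjective _).2 hp }
  refine (depthGE_iff_subsingleton_ext (ModuleCat.of A L) _).2 fun j hj => ?_
  rcases j with _ | j
  · have h0 := hP' 0 (by omega)
    have h1 : Subsingleton (ModuleCat.of A (Shrink.{u} (A ⧸ maximalIdeal A)) ⟶ ModuleCat.of A P) :=
      Ext.addEquiv₀.subsingleton_congr.1 h0
    have h2 : Subsingleton (ModuleCat.of A (Shrink.{u} (A ⧸ maximalIdeal A)) ⟶ ModuleCat.of A L) :=
      ⟨fun a b => by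
        have : Mono C.f := hC.mono_f
        exact (cancel_mono C.f).1 (h1.elim _ _)⟩
    exact Ext.addEquiv₀.subsingleton_congr.2 h2
  · have zero1 := AddCommGrpCat.isZero_of_iff_subsingleton.mpr (hX' j (by omega))
    have zero2 := AddCommGrpCat.isZero_of_iff_subsingleton.mpr (hP' (j + 1) (by omega))
    exact AddCommGrpCat.subsingleton_of_isZero <| ShortComplex.Exact.isZero_of_both_zeros
      ((Ext.covariant_sequence_exact₁' _ hC) j (j + 1) rfl)
      (zero1.eq_zero_of_src _) (zero2.eq_zero_of_tgt _)

end Depth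

/-! ### Depth under change of rings, and freeness over regular local rings. -/

section DepthFree

open IsLocalRing Ideal RingTheory.Sequence Pointwise

lemma DepthGE.of_restrictScalars_surjective {A B : Type u} [CommRing A] [IsLocalRing A]
    [CommRing B] [IsLocalRing B] [Algebra A B] (hs : Function.Surjective (algebraMap A B))
    {X : Type u} [AddCommGroup X] [Module A X] [Module B X] [IsScalarTower A B X] {n : ℕ}
    (h : DepthGE A X n) : DepthGE B X n := by
  obtain ⟨rs, hl, hm, hr⟩ := h
  refine ⟨rs.map (algebraMap A B), by simpa using hl, ?_,
    (isWeaklyRegular_map_algebraMap_iff B X rs).2 hr⟩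
  intro r hr
  obtain ⟨a, ha, rfl⟩ := List.mem_map.1 hr
  rw [← IsLocalRing.map_maximalIdeal_of_surjective (algebraMap A B) hs]
  exact Ideal.mem_map_of_mem _ (hm a ha)

lemma DepthGE.of_isLocalHom {A B : Type u} [CommRing A] [IsLocalRing A]
    [CommRing B] [IsLocalRing B] [Algebra A B] [IsLocalHom (algebraMap A B)]
    {X : Type u} [AddCommGroup X] [Module A X] [Module B X] [IsScalarTower A B X] {n : ℕ}
    (h : DepthGE A X n) : DepthGE B X n := by
  obtain ⟨rs, hl, hm, hr⟩ := h
  refine ⟨rs.map (algebraMap A B), by simpa using hl, ?_,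
    (isWeaklyRegular_map_algebraMap_iff B X rs).2 hr⟩
  intro r hr
  obtain ⟨a, ha, rfl⟩ := List.mem_map.1 hr
  exact (mem_maximalIdeal _).2 (map_nonunit (algebraMap A B) a (hm a ha))

/-- Depth over the larger ring is at most depth over the smaller ring, if the maximal ideal of the
larger ring is the radical of the extension of that of the smaller one. -/
lemma DepthGE.restrictScalars {A B : Type u} [CommRing A] [IsLocalRing A] [IsNoetherianRing A]
    [CommRing B] [IsLocalRing B] [IsNoetherianRing B] [Algebra A B] [Module.Finite A B]
    [IsLocalHom (algebraMap A B)]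
    (hrad : maximalIdeal B ≤ ((maximalIdeal A).map (algebraMap A B)).radical) (n : ℕ) :
    ∀ {X : Type u} [AddCommGroup X] [Module A X] [Module B X] [IsScalarTower A B X]
      [Module.Finite B X], DepthGE B X n → DepthGE A X n := by
  induction n with
  | zero => exact fun _ => ⟨[], rfl, by simp, IsWeaklyRegular.nil A _⟩
  | succ n ih =>
    intro X _ _ _ _ _ h
    have hfinX : Module.Finite A X := Module.Finite.trans B X
    obtain ⟨x, hx, hreg⟩ : ∃ x ∈ maximalIdeal A, IsSMulRegular X x := by
      -- For g : A/m → X the element g(1) is killed by mB, hence by a power of the X-regular first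
      -- term r of the sequence over B, and so vanishes. Once Hom(A/m, X) = 0, the ideal m contains
      -- an X-regular element.
      have : Subsingleton ((A ⧸ maximalIdeal A) →ₗ[A] X) := by
        refine ⟨fun g₁ g₂ => ?_⟩
        suffices H : ∀ g : (A ⧸ maximalIdeal A) →ₗ[A] X, g = 0 by rw [H g₁, H g₂]
        intro g
        obtain ⟨rs, hl, hm, hr⟩ := h
        rcases rs with _ | ⟨r, rs⟩
        · simp at hl
        · have hreg := ((isWeaklyRegular_cons_iff X r rs).1 hr).1
          obtain ⟨N, hN⟩ := hrad (hm r (by simp))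
          have hv : ∀ b ∈ (maximalIdeal A).map (algebraMap A B), b • g 1 = 0 := by
            intro b hb
            have hle : (maximalIdeal A).map (algebraMap A B) ≤
                LinearMap.ker (LinearMap.toSpanSingleton B X (g 1)) := by
              rw [Ideal.map_le_iff_le_comap]
              intro a ha
              rw [Ideal.mem_comap, LinearMap.mem_ker, LinearMap.toSpanSingleton_apply,
                algebraMap_smul, ← map_smul, Algebra.smul_def, Ideal.Quotient.algebraMap_eq,
                Ideal.Quotient.eq_zero_iff_mem.2 ha, zero_mul, map_zero]
            exact LinearMap.mem_ker.1 (hle hb)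
          have hg1 : g 1 = 0 := (hreg.pow N).right_eq_zero_of_smul (hv _ hN)
          ext
          simpa using hg1
      obtain ⟨x, hx, hreg⟩ := IsSMulRegular.subsingleton_linearMap_iff.1 this
      rw [Ideal.annihilator_quotient] at hx
      exact ⟨x, hx, hreg⟩
    have hregB : IsSMulRegular X (algebraMap A B x) := by
      intro u v huv
      exact hreg (by simpa using huv)
    obtain ⟨rs, hl, hm, hr⟩ := ih (h.quotSMulTop hregB)
    refine ⟨x :: rs, by simp [hl], by simpa using ⟨hx, hm⟩, ?_⟩
    rw [← isWeaklyRegular_map_algebraMap_iff B X, List.map_cons, isWeaklyRegular_cons_iff]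
    exact ⟨hregB, (isWeaklyRegular_map_algebraMap_iff B _ rs).2 hr⟩

lemma DepthGE.of_surjective {A B : Type u} [CommRing A] [IsLocalRing A]
    [CommRing B] [IsLocalRing B] [Algebra A B] (hs : Function.Surjective (algebraMap A B))
    {X : Type u} [AddCommGroup X] [Module A X] [Module B X] [IsScalarTower A B X] {n : ℕ}
    (h : DepthGE B X n) : DepthGE A X n := by
  obtain ⟨rs, hl, hm, hr⟩ := h
  obtain ⟨as, rfl⟩ := (List.map_surjective_iff.2 hs) rs
  refine ⟨as, by simpa using hl, ?_, (isWeaklyRegular_map_algebraMap_iff B X as).1 hr⟩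
  intro a ha
  have h1 := hm _ (List.mem_map_of_mem ha)
  by_contra hna
  rw [mem_maximalIdeal, mem_nonunits_iff, not_not] at hna
  exact (mem_maximalIdeal _).1 h1 (hna.map (algebraMap A B))

/-- The case of depth equal to the dimension of the Auslander-Buchsbaum formula over a regular local
ring. -/
theorem IsRegularLocalRing.free_of_depthGE (d : ℕ) : ∀ (S : Type u) [CommRing S]
    [IsRegularLocalRing S], ringKrullDim S = d → ∀ (X : Type u) [AddCommGroup X] [Module S X]
    [Module.Finite S X], DepthGE S X d → Module.Free S X := by
  induction d with
  | zero =>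
    intro S _ _ hd X _ _ _ _
    let := (IsRegularLocalRing.isField_of_ringKrullDim_eq_zero (by simpa using hd)).toField
    exact Module.Free.of_divisionRing S X
  | succ d ih =>
    intro S _ _ hd X _ _ _ h
    have hne : ∀ p ∈ associatedPrimes S X, p ≠ maximalIdeal S := by
      rintro p hp rfl
      obtain ⟨rs, hl, hm, hr⟩ := h
      rcases rs with _ | ⟨r, rs⟩
      · simp at hl
      · have hreg := ((isWeaklyRegular_cons_iff X r rs).1 hr).1
        have hmem : r ∈ ⋃ p ∈ associatedPrimes S X, (p : Set S) :=
          Set.mem_biUnion hp (hm r (by simp))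
        rw [biUnion_associatedPrimes_eq_compl_regular] at hmem
        exact hmem hreg
    -- The chosen x is both X-regular and a regular parameter: X/xX is free over the regular ring
    -- S/(x) by induction, and freeness lifts along an X-regular element.
    obtain ⟨x, hx, hx2, hxp⟩ := IsLocalRing.exists_mem_maximalIdeal_notMem_sq
      (IsLocalRing.not_isField_of_ringKrullDim_eq_succ hd) (associatedPrimes.finite S X)
      (fun p hp => hp.1) hne
    have hreg : IsSMulRegular X x := by
      by_contra hcon
      have hmem : x ∈ ⋃ p ∈ associatedPrimes S X, (p : Set S) := by
        rw [biUnion_associatedPrimes_eq_compl_regular]; exact hcon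
      obtain ⟨p, hp, hxp'⟩ := Set.mem_iUnion₂.1 hmem
      exact hxp p hp hxp'
    obtain ⟨_, _, hd'⟩ := IsRegularLocalRing.quotient_span_singleton hx hx2 hd
    have hfin : Module.Finite (S ⧸ span {x}) (QuotSMulTop x X) :=
      Module.Finite.of_restrictScalars_finite S _ _
    have hfree := ih (S ⧸ span {x}) hd' (QuotSMulTop x X)
      ((h.quotSMulTop hreg).of_restrictScalars_surjective Ideal.Quotient.mk_surjective)
    have := Module.finitePresentation_of_finite S X
    refine (Module.free_quotSMulTop_iff_free S X ?_ hreg).1 hfree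
    rwa [IsLocalRing.jacobson_eq_maximalIdeal _ bot_ne_top]

theorem IsRegularLocalRing.depthGE_of_ringKrullDim_eq (d : ℕ) : ∀ (S : Type u) [CommRing S]
    [IsRegularLocalRing S], ringKrullDim S = d → DepthGE S S d := by
  induction d with
  | zero => exact fun S _ _ _ => ⟨[], rfl, by simp, IsWeaklyRegular.nil S S⟩
  | succ d ih =>
    intro S _ _ hd
    obtain ⟨x, hx, hx2, -⟩ := IsLocalRing.exists_mem_maximalIdeal_notMem_sq
      (IsLocalRing.not_isField_of_ringKrullDim_eq_succ hd) (Set.finite_empty (α := Ideal S))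
      (by simp) (by simp)
    have := IsRegularLocalRing.isDomain S
    have hx0 : x ≠ 0 := by
      rintro rfl
      exact hx2 (Ideal.zero_mem _)
    obtain ⟨_, _, hd'⟩ := IsRegularLocalRing.quotient_span_singleton hx hx2 hd
    have h := (ih (S ⧸ span {x}) hd').of_surjective (A := S) Ideal.Quotient.mk_surjective
    refine DepthGE.cons hx ?_ (h.of_linearEquiv ?_)
    · intro u v huv
      exact mul_left_cancel₀ hx0 huv
    · exact Submodule.quotEquivOfEq _ _ (by
        rw [← Submodule.ideal_span_singleton_smul, smul_eq_mul, Ideal.mul_top])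

/-- Over a regular local ring, flat modules admit a weakly regular sequence of length the
dimension. -/
lemma IsRegularLocalRing.exists_isWeaklyRegular_of_flat {S : Type u} [CommRing S]
    [IsRegularLocalRing S] {d : ℕ} (hd : ringKrullDim S = d) :
    ∃ rs : List S, rs.length = d ∧ (∀ r ∈ rs, r ∈ maximalIdeal S) ∧
      ∀ (X : Type u) [AddCommGroup X] [Module S X] [Module.Flat S X], IsWeaklyRegular X rs := by
  obtain ⟨rs, hl, hm, hr⟩ := IsRegularLocalRing.depthGE_of_ringKrullDim_eq d S hd
  refine ⟨rs, hl, hm, fun X _ _ _ => ?_⟩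
  exact ((TensorProduct.lid S X).isWeaklyRegular_congr rs).1
    hr.isWeaklyRegular_rTensor

end DepthFree

/-! ### Regular sequences on the cycles of an unbounded exact complex. -/

section Cycles

open RingTheory.Sequence

/-- A weakly regular sequence on the terms of an exact complex without end is weakly regular on
the cycles. -/
theorem RingTheory.Sequence.IsWeaklyRegular.of_shortExact_family {A : Type*} [CommRing A]
    (rs : List A) : ∀ (E Z : ℤ → Type u) [∀ i, AddCommGroup (E i)] [∀ i, AddCommGroup (Z i)]
      [∀ i, Module A (E i)] [∀ i, Module A (Z i)] (ι : ∀ i, Z (i + 1) →ₗ[A] E i)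
      (π : ∀ i, E i →ₗ[A] Z i), (∀ i, Function.Injective (ι i)) →
      (∀ i, Function.Exact (ι i) (π i)) → (∀ i, Function.Surjective (π i)) →
      (∀ i, IsWeaklyRegular (E i) rs) → ∀ i, IsWeaklyRegular (Z i) rs := by
  induction rs with
  | nil => exact fun E Z _ _ _ _ ι π _ _ _ _ i => IsWeaklyRegular.nil A _
  | cons r rs ih =>
    intro E Z _ _ _ _ ι π hι hex hπ hE
    -- Every cycle module embeds in a term of the complex. Regularity of r on the quotients Z i then
    -- keeps the short exact sequences exact modulo r, so the induction applies to the reduced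
    -- family.
    have hreg : ∀ i, IsSMulRegular (Z i) r := by
      intro i
      obtain ⟨j, rfl⟩ : ∃ j, i = j + 1 := ⟨i - 1, by ring⟩
      exact ((isWeaklyRegular_cons_iff _ _ _).1 (hE j)).1.of_injective (ι j) (hι j)
    have key := ih (fun i => QuotSMulTop r (E i)) (fun i => QuotSMulTop r (Z i))
      (fun i => QuotSMulTop.map r (ι i)) (fun i => QuotSMulTop.map r (π i)) ?_ ?_ ?_ ?_
    · exact fun i => (key i).cons (hreg i)
    · intro i
      have h0 : Function.Exact (0 : Z (i + 1) →ₗ[A] Z (i + 1)) (ι i) :=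
        (LinearMap.exact_zero_iff_injective _ _).2 (hι i)
      have h := QuotSMulTop.map_first_exact_on_four_term_exact_of_isSMulRegular_last h0 (hex i)
        (hreg i)
      rw [map_zero] at h
      exact (LinearMap.exact_zero_iff_injective _ _).1 h
    · intro i
      exact QuotSMulTop.map_exact r (hex i) (hπ i)
    · intro i
      exact QuotSMulTop.map_surjective r (hπ i)
    · intro i
      exact ((isWeaklyRegular_cons_iff _ _ _).1 (hE i)).2

end Cycles

/-! ### The ring R^# over S and its Frobenius form. -/

namespace BranchedCover

open IsLocalRing Polynomial

section Local

variable {S : Type u} [CommRing S] [IsLocalRing S] (f : maximalIdeal S) (n : ℕ)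

/-- The class of `y` in `S[y]/(f + y^n)`. -/
noncomputable abbrev root : BranchedCover f n := AdjoinRoot.root (C (f : S) + X ^ n)

lemma monic [NeZero n] : (C (f : S) + X ^ n).Monic := by
  rw [add_comm]
  exact monic_X_pow_add_C _ (NeZero.ne n)

lemma natDegree_eq [NeZero n] : (C (f : S) + X ^ n).natDegree = n := by
  rw [add_comm]
  exact natDegree_X_pow_add_C

lemma root_pow : root f n ^ n = - algebraMap S (BranchedCover f n) f := by
  have h := AdjoinRoot.mk_self (f := C (f : S) + X ^ n)
  rw [map_add, map_pow, AdjoinRoot.mk_C, AdjoinRoot.mk_X] at h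
  exact eq_neg_of_add_eq_zero_right h

variable [NeZero n]

instance instFree : Module.Free S (BranchedCover f n) := (monic f n).free_adjoinRoot

instance instFinite : Module.Finite S (BranchedCover f n) := (monic f n).finite_adjoinRoot

lemma toHypersurface_root : toHypersurface f n (root f n) = 0 := AdjoinRoot.lift_root _

lemma toHypersurface_algebraMap (s : S) :
    toHypersurface f n (algebraMap S _ s) = Ideal.Quotient.mk _ s := AdjoinRoot.lift_of _

lemma toHypersurface_surjective : Function.Surjective (toHypersurface f n) := by
  intro z
  obtain ⟨s, rfl⟩ := Ideal.Quotient.mk_surjective z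
  exact ⟨_, toHypersurface_algebraMap f n s⟩

lemma ker_toHypersurface : RingHom.ker (toHypersurface f n) = Ideal.span {root f n} := by
  refine le_antisymm (fun x hx => ?_) ?_
  · obtain ⟨p, rfl⟩ := AdjoinRoot.mk_surjective x
    have h0 : p.coeff 0 ∈ Ideal.span {(f : S)} := by
      rw [← Ideal.Quotient.eq_zero_iff_mem]
      simpa [toHypersurface, AdjoinRoot.lift_mk, Polynomial.eval₂_at_zero] using hx
    obtain ⟨c, hc⟩ := Ideal.mem_span_singleton'.1 h0
    have hy : root f n ∈ Ideal.span {root f n} := Ideal.mem_span_singleton_self _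
    have hf : AdjoinRoot.of (C (f : S) + X ^ n) (f : S) ∈ Ideal.span {root f n} := by
      have h := (Ideal.span {root f n}).neg_mem
        (Ideal.pow_mem_of_mem _ hy n (Nat.pos_of_ne_zero (NeZero.ne n)))
      rwa [root_pow, neg_neg] at h
    rw [← Polynomial.divX_mul_X_add p, map_add, map_mul, AdjoinRoot.mk_X, AdjoinRoot.mk_C, ← hc,
      map_mul]
    exact Ideal.add_mem _ (Ideal.mul_mem_left _ _ hy) (Ideal.mul_mem_left _ _ hf)
  · rw [Ideal.span_singleton_le_iff_mem, RingHom.mem_ker]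
    exact toHypersurface_root f n

instance instIsLocalHom : IsLocalHom (algebraMap S (BranchedCover f n)) := by
  refine ⟨fun a ha => ?_⟩
  have h := ha.map (toHypersurface f n)
  rw [toHypersurface_algebraMap] at h
  have : IsLocalHom (Ideal.Quotient.mk (Ideal.span {(f : S)})) :=
    IsLocalHom.of_surjective _ Ideal.Quotient.mk_surjective
  exact isUnit_of_map_unit _ _ h

/-- A prime containing the extended ideal contracts to the maximal ideal of S, so it is maximal by
integrality. -/
lemma maximalIdeal_le_radical : maximalIdeal (BranchedCover f n) ≤
    ((maximalIdeal S).map (algebraMap S (BranchedCover f n))).radical := by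
  rw [Ideal.radical_eq_sInf]
  refine le_sInf ?_
  rintro p ⟨hp, hprime⟩
  have hcomap : p.comap (algebraMap S (BranchedCover f n)) = maximalIdeal S := by
    refine ((maximalIdeal.isMaximal S).eq_of_le ?_ (Ideal.map_le_iff_le_comap.1 hp)).symm
    exact Ideal.comap_ne_top _ hprime.ne_top
  have : p.IsMaximal := Ideal.isMaximal_of_isIntegral_of_isMaximal_comap (R := S) p
    (by rw [hcomap]; exact maximalIdeal.isMaximal S)
  exact (IsLocalRing.eq_maximalIdeal this).ge

/-- The coefficient of `y^(n-1)`. -/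
noncomputable def trace : BranchedCover f n →ₗ[S] S :=
  lcoeff S (n - 1) ∘ₗ AdjoinRoot.modByMonicHom (monic f n)

lemma trace_mk {p : S[X]} (hp : p.natDegree < n) :
    trace f n (AdjoinRoot.mk _ p) = p.coeff (n - 1) := by
  have hlt : p.degree < (C (f : S) + X ^ n).degree := by
    rw [degree_eq_natDegree (monic f n).ne_zero, natDegree_eq]
    exact (degree_le_natDegree).trans_lt (by exact_mod_cast hp)
  rw [trace, LinearMap.comp_apply, AdjoinRoot.modByMonicHom_mk,
    (modByMonic_eq_self_iff (monic f n)).2 hlt, lcoeff_apply]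

lemma trace_root_pow {i : ℕ} (hi : i < n) :
    trace f n (root f n ^ i) = if i = n - 1 then 1 else 0 := by
  have h : root f n ^ i = AdjoinRoot.mk _ (X ^ i) := by rw [map_pow, AdjoinRoot.mk_X]
  rw [h, trace_mk f n ((natDegree_X_pow_le i).trans_lt hi), coeff_X_pow]
  simp only [eq_comm]

lemma eq_zero_of_trace_mul {z : BranchedCover f n} (hz : ∀ q, trace f n (q * z) = 0) : z = 0 := by
  obtain ⟨p, rfl⟩ := AdjoinRoot.mk_surjective z
  have hpm : AdjoinRoot.mk (C (f : S) + X ^ n) p = AdjoinRoot.mk _ (p %ₘ (C (f : S) + X ^ n)) := by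
    rw [AdjoinRoot.mk_eq_mk, modByMonic_eq_sub_mul_div, sub_sub_cancel]
    exact dvd_mul_right _ _
  rw [hpm] at hz ⊢
  have hlt : (p %ₘ (C (f : S) + X ^ n)).natDegree < n := by
    have h := natDegree_modByMonic_lt p (monic f n) (by
      intro h1
      have h2 := natDegree_eq f n
      rw [h1, natDegree_one] at h2
      exact NeZero.ne n h2.symm)
    rwa [natDegree_eq] at h
  set r := p %ₘ (C (f : S) + X ^ n)
  -- Multiplying by this power of y moves the leading coefficient of the remainder r to degree n -
  -- 1, without wrapping around.
  have h := hz (AdjoinRoot.mk _ (X ^ (n - 1 - r.natDegree)))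
  rw [← map_mul, trace_mk] at h
  · rw [coeff_X_pow_mul', if_pos (by omega), show n - 1 - (n - 1 - r.natDegree) = r.natDegree by omega,
      coeff_natDegree, leadingCoeff_eq_zero] at h
    rw [h, map_zero]
  · refine (natDegree_mul_le).trans_lt ?_
    have := natDegree_X_pow_le (R := S) (n - 1 - r.natDegree)
    omega

variable {f n}

/-- An `S`-linear map that commutes with `y` is linear over the branched cover. -/
def linearMapOfRoot {Y Z : Type*} [AddCommGroup Y] [Module S Y] [Module (BranchedCover f n) Y]
    [IsScalarTower S (BranchedCover f n) Y] [AddCommGroup Z] [Module S Z]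
    [Module (BranchedCover f n) Z] [IsScalarTower S (BranchedCover f n) Z] (g : Y →ₗ[S] Z)
    (hg : ∀ v, g (root f n • v) = root f n • g v) : Y →ₗ[BranchedCover f n] Z where
  toFun := g
  map_add' := map_add g
  map_smul' q v := by
    obtain ⟨p, rfl⟩ := AdjoinRoot.mk_surjective q
    simp only [RingHom.id_apply]
    induction p using Polynomial.induction_on generalizing v with
    | C a =>
      have h : AdjoinRoot.mk (C (f : S) + X ^ n) (C a) = algebraMap S (BranchedCover f n) a :=
        AdjoinRoot.mk_C a
      rw [h, algebraMap_smul, algebraMap_smul, map_smul]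
    | add p q hp hq => rw [map_add, add_smul, map_add, hp, hq, add_smul]
    | monomial k a h =>
      rw [pow_succ, ← mul_assoc, map_mul, mul_smul, AdjoinRoot.mk_X, h, hg, mul_smul]

variable {Y : Type*} [AddCommGroup Y] [Module S Y] [Module (BranchedCover f n) Y]
    [IsScalarTower S (BranchedCover f n) Y]

/-- Frobenius reciprocity for `S → R^#`: an `S`-linear form is the coefficient of `y^(n-1)` of an
`R^#`-linear form. -/
lemma exists_trace_comp_eq (σ : Y →ₗ[S] S) :
    ∃ g : Y →ₗ[BranchedCover f n] BranchedCover f n, ∀ v, trace f n (g v) = σ v := by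
  -- The powers y^(n-1-i) and y^i are paired: g₀(v) = ∑ σ(y^(n-1-i) v) y^i, whose top coefficient is
  -- σ(v).
  let g₀ : Y →ₗ[S] BranchedCover f n := ∑ i ∈ Finset.range n,
    (LinearMap.toSpanSingleton S (BranchedCover f n) (root f n ^ i)) ∘ₗ σ ∘ₗ
      (LinearMap.lsmul (BranchedCover f n) Y (root f n ^ (n - 1 - i))).restrictScalars S
  have hg₀ : ∀ v, g₀ v = ∑ i ∈ Finset.range n, σ (root f n ^ (n - 1 - i) • v) • root f n ^ i := by
    intro v
    simp [g₀]
  have hcomm : ∀ v, g₀ (root f n • v) = root f n • g₀ v := by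
    intro v
    let h : ℕ → BranchedCover f n := fun j => σ (root f n ^ (n - j) • v) • root f n ^ j
    have h1 : g₀ (root f n • v) = ∑ i ∈ Finset.range n, h i := by
      rw [hg₀]
      refine Finset.sum_congr rfl fun i hi => ?_
      have hi' := Finset.mem_range.1 hi
      simp only [h]
      rw [← mul_smul, ← pow_succ, show n - 1 - i + 1 = n - i by omega]
    have h2 : root f n • g₀ v = ∑ i ∈ Finset.range n, h (i + 1) := by
      rw [hg₀, Finset.smul_sum]
      refine Finset.sum_congr rfl fun i hi => ?_
      simp only [h]
      rw [smul_comm, smul_eq_mul, ← pow_succ', show n - (i + 1) = n - 1 - i by omega]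
    -- The two sums differ by a shift of the index, and the end terms agree because y^n = -f is a
    -- scalar from S: σ(v) y^n = σ(y^n v).
    have h3 : h n = h 0 := by
      simp only [h, Nat.sub_self, pow_zero, one_smul, Nat.sub_zero]
      rw [root_pow, neg_smul, algebraMap_smul, map_neg, map_smul, smul_neg, neg_smul,
        smul_eq_mul, mul_comm, mul_smul, ← Algebra.algebraMap_eq_smul_one, Algebra.smul_def]
    have h4 := (Finset.sum_range_succ h n).symm.trans (Finset.sum_range_succ' h n)
    rw [h3] at h4
    rw [h1, h2]
    exact add_right_cancel h4
  refine ⟨linearMapOfRoot g₀ hcomm, fun v => ?_⟩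
  change trace f n (g₀ v) = σ v
  rw [hg₀, map_sum]
  have hn : n - 1 ∈ Finset.range n := Finset.mem_range.2 (Nat.sub_lt (Nat.pos_of_ne_zero (NeZero.ne n)) one_pos)
  rw [Finset.sum_eq_single_of_mem (n - 1) hn]
  · rw [map_smul, trace_root_pow f n (Finset.mem_range.1 hn)]
    simp
  · intro i hi hne
    rw [map_smul, trace_root_pow f n (Finset.mem_range.1 hi), if_neg hne, smul_zero]

/-- The image of g is an ideal in the kernel of the trace, and the trace form is nondegenerate. -/
lemma eq_zero_of_trace_comp_eq_zero {Z : Type*} [AddCommGroup Z] [Module (BranchedCover f n) Z]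
    (g : Z →ₗ[BranchedCover f n] BranchedCover f n)
    (hg : ∀ v, trace f n (g v) = 0) (v : Z) : g v = 0 := by
  refine eq_zero_of_trace_mul f n fun q => ?_
  rw [← smul_eq_mul, ← map_smul, hg]

end Local

section Regular

variable {S : Type u} [CommRing S] [IsRegularLocalRing S] (f : maximalIdeal S) (n : ℕ) [NeZero n]

instance instIsNoetherianRing : IsNoetherianRing (BranchedCover f n) :=
  IsNoetherianRing.of_finite S _

/-- The upper bound is incomparability for the integral extension; the lower bound is a maximal
regular sequence of S, still regular on the free S-module R^#. -/
lemma ringKrullDim_eq {d : ℕ} (hd : ringKrullDim S = d) :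
    ringKrullDim (BranchedCover f n) = d := by
  apply le_antisymm
  · rw [← hd]
    refine Order.krullDim_le_of_strictMono
      (PrimeSpectrum.comap (algebraMap S (BranchedCover f n))) fun p q hpq => ?_
    obtain ⟨hle, x, hxq, hxp⟩ := SetLike.lt_iff_le_and_exists.mp
      (show p.asIdeal < q.asIdeal from hpq)
    exact Ideal.comap_lt_comap_of_integral_mem_sdiff hle ⟨hxq, hxp⟩ (Algebra.IsIntegral.isIntegral x)
  · obtain ⟨rs, hl, hm, hr⟩ := IsRegularLocalRing.exists_isWeaklyRegular_of_flat hd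
    have h : DepthGE (BranchedCover f n) (BranchedCover f n) d :=
      DepthGE.of_isLocalHom (A := S) ⟨rs, hl, hm, hr _⟩
    obtain ⟨rs', hl', hm', hr'⟩ := h
    have h2 := ringKrullDim_add_length_eq_ringKrullDim_of_isRegular rs'
      (RingTheory.Sequence.IsRegular.of_isWeaklyRegular_of_mem_maximalIdeal _ hm' hr')
    rw [← h2, hl']
    have : Nontrivial (BranchedCover f n ⧸ Ideal.ofList rs') := by
      refine Ideal.Quotient.nontrivial_iff.2 fun htop => ?_
      have hle : Ideal.ofList rs' ≤ maximalIdeal _ := Ideal.span_le.2 hm'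
      rw [htop] at hle
      exact (maximalIdeal.isMaximal _).ne_top (top_le_iff.1 hle)
    exact le_add_of_nonneg_left ringKrullDim_nonneg_of_nontrivial

lemma exists_ringKrullDim_hypersurface_eq (hf : f ≠ 0) :
    ∃ e : ℕ, ringKrullDim S = (e + 1 : ℕ) ∧ ringKrullDim (Hypersurface f) = e := by
  have := IsRegularLocalRing.isDomain S
  have hf' : (f : S) ≠ 0 := fun h => hf (Subtype.ext h)
  obtain ⟨d, hd⟩ := IsRegularLocalRing.exists_ringKrullDim_eq S
  have h := ringKrullDim_quotient_span_singleton_succ_eq_ringKrullDim_of_mem_nonZeroDivisors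
    (mem_nonZeroDivisors_of_ne_zero hf') f.2
  have h0 : 0 ≤ ringKrullDim (Hypersurface f) := ringKrullDim_nonneg_of_nontrivial
  rw [hd] at h
  rcases d with _ | e
  · exfalso
    have h1 : (1 : WithBot ℕ∞) ≤ 0 := by
      calc (1 : WithBot ℕ∞) ≤ ringKrullDim (Hypersurface f) + 1 := le_add_of_nonneg_left h0
        _ = 0 := by rw [h]; rfl
    exact absurd h1 (by norm_num)
  · refine ⟨e, hd, ?_⟩
    push_cast at h
    exact ENat.WithBot.add_one_cancel.1 h

end Regular

end BranchedCover

lemma DepthGE.mono_succ {A : Type u} [CommRing A] [IsLocalRing A] [IsNoetherianRing A] {X : Type u}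
    [AddCommGroup X] [Module A X] [Module.Finite A X] {n : ℕ} (h : DepthGE A X (n + 1)) :
    DepthGE A X n :=
  (depthGE_iff_subsingleton_ext (ModuleCat.of A X) n).2 fun i hi =>
    (depthGE_iff_subsingleton_ext (ModuleCat.of A X) (n + 1)).1 h i (by omega)

/-- A module over the target of a surjection, from a module killed by the kernel. -/
lemma exists_restrictScalars_linearEquiv {A B : Type u} [CommRing A] [CommRing B] (φ : A →+* B)
    (hφ : Function.Surjective φ) (T : Type u) [AddCommGroup T] [Module A T]
    (hT : ∀ a, φ a = 0 → ∀ t : T, a • t = 0) :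
    ∃ N : ModuleCat.{u} B, Nonempty (T ≃ₗ[A] (ModuleCat.restrictScalars φ).obj N) := by
  have htors : Module.IsTorsionBySet A T (RingHom.ker φ) := fun t a => hT a a.2 t
  let := htors.module
  let := Module.compHom T
    (RingHom.quotientKerEquivOfSurjective hφ).symm.toRingHom
  refine ⟨ModuleCat.of B T, ⟨{ AddEquiv.refl T with map_smul' := fun a t => ?_ }⟩⟩
  change a • t = (RingHom.quotientKerEquivOfSurjective hφ).symm (φ a) • t
  have h : (RingHom.quotientKerEquivOfSurjective hφ).symm (φ a) = Ideal.Quotient.mk _ a := by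
    rw [RingEquiv.symm_apply_eq]
    rfl
  rw [h]
  exact (htors.mk_smul a t).symm

/-! ### Maximal Cohen-Macaulay modules over the branched cover. -/

namespace BranchedCover

open IsLocalRing

variable {S : Type u} [CommRing S] [IsRegularLocalRing S] (f : maximalIdeal S) (n : ℕ) [NeZero n]

/-- The maximal Cohen-Macaulay modules over the branched cover are those that are finitely
generated and free over `S`. -/
lemma mcm_iff_free (X : Type u) [AddCommGroup X] [Module (BranchedCover f n) X] [Module S X]
    [IsScalarTower S (BranchedCover f n) X] :
    MCM (BranchedCover f n) (ModuleCat.of _ X) ↔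
      Module.Finite (BranchedCover f n) X ∧ Module.Free S X := by
  obtain ⟨d, hd⟩ := IsRegularLocalRing.exists_ringKrullDim_eq S
  rw [mcm_iff_depthGE (ringKrullDim_eq f n hd)]
  refine and_congr_right fun hfin => ?_
  have hfin' : Module.Finite (BranchedCover f n) X := hfin
  have hfinS : Module.Finite S X := Module.Finite.trans (BranchedCover f n) X
  constructor
  · intro h
    exact IsRegularLocalRing.free_of_depthGE d S hd X
      (h.restrictScalars (maximalIdeal_le_radical f n))
  · intro h
    obtain ⟨rs, hl, hm, hr⟩ := IsRegularLocalRing.exists_isWeaklyRegular_of_flat hd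
    exact DepthGE.of_isLocalHom (A := S) ⟨rs, hl, hm, hr X⟩

lemma mcm_of_projective (X : Type u) [AddCommGroup X] [Module (BranchedCover f n) X]
    [Module.Finite (BranchedCover f n) X] [Module S X] [IsScalarTower S (BranchedCover f n) X]
    [Module.Projective S X] : MCM (BranchedCover f n) (ModuleCat.of _ X) := by
  have hfinS : Module.Finite S X := Module.Finite.trans (BranchedCover f n) X
  exact (mcm_iff_free f n X).2 ⟨inferInstance, Module.free_of_flat_of_isLocalRing⟩

lemma mcm_pi (m : ℕ) : MCM (BranchedCover f n) (ModuleCat.of _ (Fin m → BranchedCover f n)) :=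
  mcm_of_projective f n _

variable {f n}

/-- The power y^n acts as -f, which is injective on a free module over the domain S. -/
lemma isSMulRegular_root (hf : f ≠ 0) {X : Type u} [AddCommGroup X] [Module (BranchedCover f n) X]
    (hX : MCM (BranchedCover f n) (ModuleCat.of _ X)) : IsSMulRegular X (root f n) := by
  let := Module.compHom X (algebraMap S (BranchedCover f n))
  have : IsScalarTower S (BranchedCover f n) X := IsScalarTower.of_compHom _ _ _
  have := IsRegularLocalRing.isDomain S
  have hf' : (f : S) ≠ 0 := fun h => hf (Subtype.ext h)
  obtain ⟨-, hfree⟩ := (mcm_iff_free f n X).1 hX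
  have h1 : IsSMulRegular X (f : S) := fun u v huv => by
    exact smul_right_injective X hf' huv
  intro u v huv
  apply h1
  simp only at huv ⊢
  obtain ⟨k, hk⟩ := Nat.exists_eq_succ_of_ne_zero (NeZero.ne n)
  have h2 : ∀ w : X, (f : S) • w = - (root f n ^ k • root f n • w) := by
    intro w
    rw [← mul_smul, ← pow_succ, show k + 1 = n from hk.symm, root_pow, neg_smul, neg_neg,
      algebraMap_smul]
  rw [h2, h2, huv]

lemma mcm_ker {X F : Type u} [AddCommGroup X] [Module (BranchedCover f n) X]
    [AddCommGroup F] [Module (BranchedCover f n) F]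
    (hX : MCM (BranchedCover f n) (ModuleCat.of _ X))
    (hF : MCM (BranchedCover f n) (ModuleCat.of _ F)) (π : F →ₗ[BranchedCover f n] X)
    (hπ : Function.Surjective π) :
    MCM (BranchedCover f n) (ModuleCat.of _ (LinearMap.ker π)) := by
  obtain ⟨d, hd⟩ := IsRegularLocalRing.exists_ringKrullDim_eq S
  rw [mcm_iff_depthGE (ringKrullDim_eq f n hd)] at hX hF ⊢
  obtain ⟨_, hX⟩ := hX
  obtain ⟨_, hF⟩ := hF
  have h1 : Module.Finite (BranchedCover f n) X := ‹_›
  have h2 : Module.Finite (BranchedCover f n) F := ‹_›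
  have h3 : Module.Finite (BranchedCover f n) (LinearMap.ker π) := inferInstance
  refine ⟨h3, ?_⟩
  rcases d with _ | d
  · exact ⟨[], rfl, by simp, RingTheory.Sequence.IsWeaklyRegular.nil _ _⟩
  · exact DepthGE.of_shortExact (LinearMap.ker π).subtype π Subtype.val_injective
      (LinearMap.exact_subtype_ker_map π) hπ hF (DepthGE.mono_succ hX)

/-- The retraction ρ is only S-linear; that suffices to make the cokernel an S-summand of F. -/
lemma mcm_quotient_range {X F : Type u} [AddCommGroup X] [Module (BranchedCover f n) X] [Module S X]
    [IsScalarTower S (BranchedCover f n) X] [AddCommGroup F] [Module (BranchedCover f n) F]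
    [Module S F] [IsScalarTower S (BranchedCover f n) F] [Module.Finite (BranchedCover f n) F]
    [Module.Projective S F] (ι : X →ₗ[BranchedCover f n] F) (ρ : F →ₗ[S] X)
    (hρ : ∀ x, ρ (ι x) = x) : MCM (BranchedCover f n) (ModuleCat.of _ (F ⧸ LinearMap.range ι)) := by
  obtain ⟨q, hq⟩ : ∃ q : F →ₗ[S] (F ⧸ LinearMap.range ι), ∀ x, q x = (LinearMap.range ι).mkQ x :=
    ⟨(LinearMap.range ι).mkQ.restrictScalars S, fun _ => rfl⟩
  have hex : Function.Exact (ι.restrictScalars S) q := by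
    intro y
    rw [hq]
    exact LinearMap.exact_map_mkQ_range ι y
  have hsurj : Function.Surjective q := by
    intro y
    obtain ⟨x, rfl⟩ := Submodule.mkQ_surjective _ y
    exact ⟨x, hq x⟩
  have hsplit := (Function.Exact.split_tfae' hex).out 1 0
  obtain ⟨-, s, hs⟩ := hsplit.1 ⟨hsurj, ρ, LinearMap.ext hρ⟩
  have : Module.Projective S (F ⧸ LinearMap.range ι) := Module.Projective.of_split s q hs
  have : Module.Finite (BranchedCover f n) (F ⧸ LinearMap.range ι) := inferInstance
  exact mcm_of_projective f n (F ⧸ LinearMap.range ι)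

/-- A maximal Cohen-Macaulay module over the branched cover is a syzygy of another one. -/
lemma exists_mcm_quotient {X : Type u} [AddCommGroup X] [Module (BranchedCover f n) X]
    (hX : MCM (BranchedCover f n) (ModuleCat.of _ X)) :
    ∃ (m : ℕ) (ι : X →ₗ[BranchedCover f n] (Fin m → BranchedCover f n)), Function.Injective ι ∧
      MCM (BranchedCover f n) (ModuleCat.of _ ((Fin m → BranchedCover f n) ⧸ LinearMap.range ι)) := by
  let := Module.compHom X (algebraMap S (BranchedCover f n))
  have : IsScalarTower S (BranchedCover f n) X := IsScalarTower.of_compHom _ _ _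
  obtain ⟨hfin, hfree⟩ := (mcm_iff_free f n X).1 hX
  have hfinS : Module.Finite S X := Module.Finite.trans (BranchedCover f n) X
  obtain ⟨m, ⟨b⟩⟩ : ∃ m, Nonempty (Module.Basis (Fin m) S X) := ⟨_, ⟨Module.finBasis S X⟩⟩
  -- The coordinate forms of an S-basis lift to R^#-linear forms, and their traces recover the
  -- coordinates, so the resulting embedding splits over S.
  choose g hg using fun j => exists_trace_comp_eq (f := f) (n := n) (b.coord j)
  have hρ : ∀ x, (∑ j, (LinearMap.toSpanSingleton S X (b j)) ∘ₗ trace f n ∘ₗ LinearMap.proj j :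
      (Fin m → BranchedCover f n) →ₗ[S] X) (LinearMap.pi g x) = x := by
    intro x
    simp only [LinearMap.coe_comp, Function.comp_apply, LinearMap.sum_apply,
      LinearMap.toSpanSingleton_apply, LinearMap.proj_apply, LinearMap.pi_apply, hg]
    exact b.sum_repr x
  exact ⟨m, LinearMap.pi g, (Function.LeftInverse.injective hρ), mcm_quotient_range _ _ hρ⟩

/-- Maximal Cohen-Macaulay modules over the branched cover have no extensions by free modules. -/
lemma exists_extension {C F : Type u} [AddCommGroup C] [Module (BranchedCover f n) C]
    [AddCommGroup F] [Module (BranchedCover f n) F]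
    (hC : MCM (BranchedCover f n) (ModuleCat.of _ C)) (π : F →ₗ[BranchedCover f n] C)
    (hπ : Function.Surjective π) {m : ℕ}
    (ψ : LinearMap.ker π →ₗ[BranchedCover f n] (Fin m → BranchedCover f n)) :
    ∃ g : F →ₗ[BranchedCover f n] (Fin m → BranchedCover f n), ∀ x : LinearMap.ker π, g x = ψ x := by
  let := Module.compHom C (algebraMap S (BranchedCover f n))
  have : IsScalarTower S (BranchedCover f n) C := IsScalarTower.of_compHom _ _ _
  let := Module.compHom F (algebraMap S (BranchedCover f n))
  have : IsScalarTower S (BranchedCover f n) F := IsScalarTower.of_compHom _ _ _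
  obtain ⟨-, hfree⟩ := (mcm_iff_free f n C).1 hC
  have hex : Function.Exact ((LinearMap.ker π).subtype.restrictScalars S) (π.restrictScalars S) :=
    LinearMap.exact_subtype_ker_map π
  obtain ⟨s, hs⟩ := Module.projective_lifting_property (π.restrictScalars S) LinearMap.id hπ
  have hsplit := (Function.Exact.split_tfae' hex).out 0 1
  obtain ⟨-, ρ, hρ⟩ := hsplit.1 ⟨Subtype.val_injective, s, hs⟩
  -- As C is S-free, ψ extends S-linearly along the retraction ρ. Frobenius reciprocity turns the
  -- trace of each coordinate into an R^#-linear form, which agrees with ψ on the kernel because the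
  -- traces agree there.
  choose g hg using fun j => exists_trace_comp_eq (f := f) (n := n)
    (trace f n ∘ₗ LinearMap.proj j ∘ₗ ψ.restrictScalars S ∘ₗ ρ)
  refine ⟨LinearMap.pi g, fun x => funext fun j => ?_⟩
  have h := eq_zero_of_trace_comp_eq_zero (f := f) (n := n)
    (g j ∘ₗ (LinearMap.ker π).subtype - LinearMap.proj j ∘ₗ ψ) (fun v => ?_) x
  · simpa [sub_eq_zero] using h
  · have h1 := LinearMap.congr_fun hρ v
    simp only [LinearMap.coe_comp, LinearMap.coe_restrictScalars, Function.comp_apply,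
      Submodule.coe_subtype, LinearMap.id_apply] at h1
    simp [hg, h1]

end BranchedCover

/-! ### Linear factorizations and summands expressed by maps. -/

section Linear

variable {A : Type*} [CommRing A] {X Y Z : Type*} [AddCommGroup X] [Module A X] [AddCommGroup Y]
  [Module A Y] [AddCommGroup Z] [Module A Z]

lemma LinearMap.exists_comp_eq_of_injective (i : Z →ₗ[A] Y) (hi : Function.Injective i)
    (g : X →ₗ[A] Y) (hg : ∀ x, ∃ z, i z = g x) : ∃ g' : X →ₗ[A] Z, ∀ x, i (g' x) = g x := by
  choose h hh using hg
  refine ⟨{ toFun := h, map_add' := fun u v => hi ?_, map_smul' := fun c u => hi ?_ }, hh⟩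
  · rw [map_add, hh, hh, hh, map_add]
  · rw [map_smul, hh, hh, map_smul, RingHom.id_apply]

lemma LinearMap.exists_smul_eq_of_isSMulRegular {y : A} (hy : IsSMulRegular Y y) (g : X →ₗ[A] Y)
    (hg : ∀ x, ∃ z, y • z = g x) : ∃ g' : X →ₗ[A] Y, ∀ x, y • g' x = g x :=
  LinearMap.exists_comp_eq_of_injective (LinearMap.lsmul A Y y) hy g hg

/-- `X` is a direct summand of a finite direct sum of copies of `Y`, in terms of maps. -/
def IsAddRetract (A : Type*) [CommRing A] (X Y : Type*) [AddCommGroup X] [Module A X]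
    [AddCommGroup Y] [Module A Y] : Prop :=
  ∃ (ι : Type) (_ : Fintype ι) (α : ι → (X →ₗ[A] Y)) (β : ι → (Y →ₗ[A] X)),
    ∀ x, ∑ j, β j (α j x) = x

end Linear

lemma addClosure.isAddRetract {R : Type u} [CommRing R] {M N : ModuleCat.{u} R}
    (h : addClosure M N) : IsAddRetract R N M := by
  obtain ⟨k, N', ⟨e⟩⟩ := h
  refine ⟨Fin k, inferInstance,
    fun j => LinearMap.proj j ∘ₗ e.toLinearMap ∘ₗ LinearMap.inl R N N',
    fun j => LinearMap.fst R N N' ∘ₗ e.symm.toLinearMap ∘ₗ LinearMap.single R (fun _ => M) j,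
    fun x => ?_⟩
  simp only [LinearMap.coe_comp, Function.comp_apply, LinearMap.proj_apply, LinearEquiv.coe_coe]
  rw [← map_sum, ← map_sum]
  have h : ∑ j, (LinearMap.single R (fun _ => M) j) (e (LinearMap.inl R N N' x) j) =
      e (LinearMap.inl R N N' x) := by
    simpa using LinearMap.sum_single_apply (fun _ : Fin k => (M : Type u)) (e (LinearMap.inl R N N' x))
  rw [h]
  simp

lemma addClosure_self {R : Type u} [Ring R] (M : ModuleCat.{u} R) : addClosure M M :=
  ⟨1, ModuleCat.of R PUnit.{u + 1}, ⟨(LinearEquiv.prodUnique (R := R) (M := M)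
    (M₂ := PUnit.{u + 1})).trans (LinearEquiv.funUnique (Fin 1) R M).symm⟩⟩

/-! ### The representation generator and its syzygy. -/

namespace BranchedCover

open IsLocalRing

variable {S : Type u} [CommRing S] [IsRegularLocalRing S] {f : maximalIdeal S} {n : ℕ} [NeZero n]

lemma depthGE_restrictScalars_iff (N : ModuleCat.{u} (Hypersurface f)) (e : ℕ) :
    DepthGE (BranchedCover f n) ((ModuleCat.restrictScalars (toHypersurface f n)).obj N) e ↔
      DepthGE (Hypersurface f) N e := by
  let := (toHypersurface f n).toAlgebra
  let := Module.compHom N (toHypersurface f n)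
  have : IsScalarTower (BranchedCover f n) (Hypersurface f) N := IsScalarTower.of_compHom _ _ _
  change DepthGE (BranchedCover f n) N e ↔ _
  exact ⟨fun h => DepthGE.of_restrictScalars_surjective (A := BranchedCover f n)
      (toHypersurface_surjective f n) h,
    fun h => DepthGE.of_surjective (A := BranchedCover f n) (B := Hypersurface f)
      (toHypersurface_surjective f n) h⟩

lemma finite_restrictScalars_iff (N : ModuleCat.{u} (Hypersurface f)) :
    Module.Finite (BranchedCover f n) ((ModuleCat.restrictScalars (toHypersurface f n)).obj N) ↔
      Module.Finite (Hypersurface f) N := by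
  let := (toHypersurface f n).toAlgebra
  let := Module.compHom N (toHypersurface f n)
  have : IsScalarTower (BranchedCover f n) (Hypersurface f) N := IsScalarTower.of_compHom _ _ _
  have : Module.Finite (BranchedCover f n) (Hypersurface f) :=
    Module.Finite.of_surjective (Algebra.linearMap _ _) (toHypersurface_surjective f n)
  change Module.Finite (BranchedCover f n) N ↔ _
  exact ⟨fun h => Module.Finite.of_restrictScalars_finite (BranchedCover f n) (Hypersurface f) N,
    fun h => Module.Finite.trans (Hypersurface f) N⟩

/-- `X/yX` is maximal Cohen-Macaulay over the hypersurface, hence lies in `add M`. -/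
lemma isAddRetract_quotSMulTop (hf : f ≠ 0) {M : ModuleCat.{u} (Hypersurface f)}
    (hM : IsRepresentationGenerator M) {X : Type u} [AddCommGroup X] [Module (BranchedCover f n) X]
    (hX : MCM (BranchedCover f n) (ModuleCat.of _ X)) :
    IsAddRetract (BranchedCover f n) (QuotSMulTop (root f n) X)
      ((ModuleCat.restrictScalars (toHypersurface f n)).obj M) := by
  obtain ⟨e, hdS, hdR⟩ := exists_ringKrullDim_hypersurface_eq f hf
  have hreg := isSMulRegular_root hf hX
  rw [mcm_iff_depthGE (ringKrullDim_eq f n hdS)] at hX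
  obtain ⟨hfin, hdepth⟩ := hX
  have hfin' : Module.Finite (BranchedCover f n) X := hfin
  obtain ⟨N, ⟨ε⟩⟩ := exists_restrictScalars_linearEquiv (toHypersurface f n)
    (toHypersurface_surjective f n) (QuotSMulTop (root f n) X) (fun a ha t => by
      have ha' : a ∈ Ideal.span {root f n} := by
        rw [← ker_toHypersurface]; exact ha
      obtain ⟨c, rfl⟩ := Ideal.mem_span_singleton'.1 ha'
      obtain ⟨x, rfl⟩ := Submodule.mkQ_surjective _ t
      rw [← map_smul, Submodule.mkQ_apply, Submodule.Quotient.mk_eq_zero, mul_comm, mul_smul]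
      exact Submodule.smul_mem_pointwise_smul _ _ _ trivial)
  have hN : MCM (Hypersurface f) N := by
    rw [mcm_iff_depthGE hdR]
    exact ⟨(finite_restrictScalars_iff (n := n) N).1 (Module.Finite.equiv ε),
      (depthGE_restrictScalars_iff (n := n) N e).1 ((hdepth.quotSMulTop hreg).of_linearEquiv ε)⟩
  rw [IsRepresentationGenerator] at hM
  rw [← hM] at hN
  obtain ⟨ι, _, α, β, hαβ⟩ := hN.isAddRetract
  refine ⟨ι, inferInstance,
    fun j => ((ModuleCat.restrictScalars (toHypersurface f n)).map (ModuleCat.ofHom (α j))).hom ∘ₗ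
      ε.toLinearMap,
    fun j => ε.symm.toLinearMap ∘ₗ
      ((ModuleCat.restrictScalars (toHypersurface f n)).map (ModuleCat.ofHom (β j))).hom,
    fun x => ?_⟩
  simp only [LinearMap.coe_comp, Function.comp_apply, LinearEquiv.coe_coe]
  rw [← map_sum, LinearEquiv.symm_apply_eq]
  exact hαβ (ε x)

lemma mcm_hypersurface_self (hf : f ≠ 0) :
    MCM (Hypersurface f) (ModuleCat.of _ (Hypersurface f)) := by
  obtain ⟨e, hdS, hdR⟩ := exists_ringKrullDim_hypersurface_eq f hf
  rw [mcm_iff_depthGE hdR]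
  refine ⟨Module.Finite.self _, ?_⟩
  have := IsRegularLocalRing.isDomain S
  have hf' : (f : S) ≠ 0 := fun h => hf (Subtype.ext h)
  have h := (IsRegularLocalRing.depthGE_of_ringKrullDim_eq _ S hdS).quotSMulTop (x := (f : S))
    (fun u v huv => mul_left_cancel₀ hf' huv)
  refine DepthGE.of_restrictScalars_surjective (A := S) Ideal.Quotient.mk_surjective
    (h.of_linearEquiv ?_)
  exact Submodule.quotEquivOfEq _ _ (by
    rw [← Submodule.ideal_span_singleton_smul, smul_eq_mul, Ideal.mul_top])

/-- R is MCM, hence in `add M`, so 1 is a sum of terms β_j(α_j(1)); in a local ring one of them is a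
unit. -/
lemma exists_apply_eq_one (hf : f ≠ 0) {M : ModuleCat.{u} (Hypersurface f)}
    (hM : IsRepresentationGenerator M) : ∃ (B : M →ₗ[Hypersurface f] Hypersurface f) (v : M),
      B v = 1 := by
  have h := mcm_hypersurface_self hf
  rw [IsRepresentationGenerator] at hM
  rw [← hM] at h
  obtain ⟨ι, _, α, β, hαβ⟩ := h.isAddRetract
  have h1 : ∑ j, β j (α j 1) = (1 : Hypersurface f) := hαβ 1
  obtain ⟨j, hj⟩ : ∃ j, IsUnit (β j (α j 1) : Hypersurface f) := by
    by_contra! hcon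
    have h2 : ∑ j, (β j (α j 1) : Hypersurface f) ∈ maximalIdeal (Hypersurface f) :=
      Ideal.sum_mem _ fun j _ => (mem_maximalIdeal _).2 (hcon j)
    rw [h1] at h2
    exact (mem_maximalIdeal _).1 h2 isUnit_one
  obtain ⟨w, hw⟩ := hj.exists_left_inv
  refine ⟨β j, w • α j 1, ?_⟩
  rw [map_smul]
  exact hw

lemma mcm_of_module_projective {P : Type u} [AddCommGroup P] [Module (BranchedCover f n) P]
    [Module.Finite (BranchedCover f n) P] [Module.Projective (BranchedCover f n) P] :
    MCM (BranchedCover f n) (ModuleCat.of _ P) := by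
  let := Module.compHom P (algebraMap S (BranchedCover f n))
  have : IsScalarTower S (BranchedCover f n) P := IsScalarTower.of_compHom _ _ _
  have : Module.Free (BranchedCover f n) P := Module.free_of_flat_of_isLocalRing
  have : Module.Free S P := Module.Free.trans (S := BranchedCover f n)
  exact mcm_of_projective f n P

section Syzygy

variable {M : ModuleCat.{u} (Hypersurface f)} {Mt P : Type u} [AddCommGroup Mt]
  [Module (BranchedCover f n) Mt] [AddCommGroup P] [Module (BranchedCover f n) P]
  [Module.Projective (BranchedCover f n) P] {i : Mt →ₗ[BranchedCover f n] P}
  {p : P →ₗ[BranchedCover f n] ((ModuleCat.restrictScalars (toHypersurface f n)).obj M)}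

/-- The depth of M is dim R = dim R^# - 1, and the depth lemma gains the missing one. -/
lemma mcm_syzygy [Module.Finite (BranchedCover f n) P] (hf : f ≠ 0) (hM : IsRepresentationGenerator M) (hi : Function.Injective i)
    (hip : Function.Exact i p) (hp : Function.Surjective p) :
    MCM (BranchedCover f n) (ModuleCat.of _ Mt) := by
  obtain ⟨e, hdS, hdR⟩ := exists_ringKrullDim_hypersurface_eq f hf
  have hM' : MCM (Hypersurface f) M := by
    rw [← show addClosure M = MCM _ from hM]
    exact addClosure_self M
  have hP := mcm_of_module_projective (f := f) (n := n) (P := P)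
  rw [mcm_iff_depthGE hdR] at hM'
  rw [mcm_iff_depthGE (ringKrullDim_eq f n hdS)] at hP ⊢
  have h1 : Module.Finite (BranchedCover f n) Mt := Module.Finite.of_injective i hi
  have h2 := (finite_restrictScalars_iff (n := n) M).2 hM'.1
  exact ⟨h1, DepthGE.of_shortExact i p hi hip hp hP.2
    ((depthGE_restrictScalars_iff (n := n) M e).2 hM'.2)⟩

lemma root_smul_restrictScalars (t : (ModuleCat.restrictScalars (toHypersurface f n)).obj M) :
    root f n • t = 0 := by
  rw [ModuleCat.restrictScalars.smul_def, toHypersurface_root, zero_smul]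
  rfl

/-- The branched cover is a direct summand of the syzygy of a representation generator. -/
lemma exists_syzygy_apply_eq_one (hf : f ≠ 0) (hM : IsRepresentationGenerator M)
    (hip : Function.Exact i p) (hp : Function.Surjective p) :
    ∃ (a : Mt →ₗ[BranchedCover f n] BranchedCover f n) (b : Mt), a b = 1 := by
  obtain ⟨B, v, hBv⟩ := exists_apply_eq_one hf hM
  let R' := (ModuleCat.restrictScalars (toHypersurface f n)).obj (ModuleCat.of _ (Hypersurface f))
  let B' : ((ModuleCat.restrictScalars (toHypersurface f n)).obj M) →ₗ[BranchedCover f n] R' :=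
    ((ModuleCat.restrictScalars (toHypersurface f n)).map
      (Y := ModuleCat.of _ (Hypersurface f)) (ModuleCat.ofHom B)).hom
  let q : BranchedCover f n →ₗ[BranchedCover f n] R' :=
    { toFun := toHypersurface f n
      map_add' := map_add _
      map_smul' := fun c x => map_mul (toHypersurface f n) c x }
  -- The form B ∘ p lifts to h : P → R^#. On the syzygy h takes values in (y), so h = y a there; for
  -- w over v, h(w) is a unit and yw comes from some b in the syzygy, with a(b) = h(w).
  obtain ⟨h, hh⟩ := Module.projective_lifting_property q (B' ∘ₗ p) (toHypersurface_surjective f n)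
  have hh' : ∀ x, toHypersurface f n (h x) = B (p x) := fun x => LinearMap.congr_fun hh x
  obtain ⟨w, hw⟩ := hp v
  have hu : IsUnit (h w) := by
    have : IsLocalHom (toHypersurface f n) :=
      IsLocalHom.of_surjective _ (toHypersurface_surjective f n)
    refine isUnit_of_map_unit (toHypersurface f n) _ ?_
    have h1 : toHypersurface f n (h w) = 1 := by
      rw [hh', hw]
      exact hBv
    rw [h1]
    exact isUnit_one
  have hreg : IsSMulRegular (BranchedCover f n) (root f n) :=
    isSMulRegular_root hf mcm_of_module_projective
  obtain ⟨a, ha⟩ := LinearMap.exists_smul_eq_of_isSMulRegular hreg (h ∘ₗ i) (fun x => by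
    have h1 : h (i x) ∈ RingHom.ker (toHypersurface f n) := by
      rw [RingHom.mem_ker, hh', hip.apply_apply_eq_zero]
      exact map_zero B
    rw [ker_toHypersurface] at h1
    obtain ⟨c, hc⟩ := Ideal.mem_span_singleton'.1 h1
    exact ⟨c, by rw [smul_eq_mul, mul_comm, hc]; rfl⟩)
  obtain ⟨b, hb⟩ := (hip (root f n • w)).1 (by rw [map_smul, root_smul_restrictScalars])
  have hab : a b = h w := by
    apply hreg
    simp only
    rw [ha, LinearMap.comp_apply, hb, map_smul]
  obtain ⟨c, hc⟩ := hu.exists_left_inv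
  exact ⟨a, c • b, by rw [map_smul, hab, smul_eq_mul, hc]⟩

end Syzygy

end BranchedCover

/-! ### Approximation of MCM modules by the additive closure of the syzygy. -/

namespace BranchedCover

open IsLocalRing Pointwise

variable {S : Type u} [CommRing S] [IsRegularLocalRing S] {f : maximalIdeal S} {n : ℕ} [NeZero n]

section Approximation

variable {M : ModuleCat.{u} (Hypersurface f)} {Mt P : Type u} [AddCommGroup Mt]
  [Module (BranchedCover f n) Mt] [AddCommGroup P] [Module (BranchedCover f n) P]
  {i : Mt →ₗ[BranchedCover f n] P}
  {p : P →ₗ[BranchedCover f n] ((ModuleCat.restrictScalars (toHypersurface f n)).obj M)}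
  {X : Type u} [AddCommGroup X] [Module (BranchedCover f n) X] {m : ℕ}
  (π : (Fin m → BranchedCover f n) →ₗ[BranchedCover f n] X)

/-- The inverse image of `yX` under a free cover `F → X`. -/
noncomputable def approx : Submodule (BranchedCover f n) (Fin m → BranchedCover f n) :=
  (root f n • (⊤ : Submodule (BranchedCover f n) X)).comap π

lemma mem_approx_iff (k : Fin m → BranchedCover f n) :
    k ∈ approx π ↔ ∃ x, root f n • x = π k := by
  simp [approx, Submodule.mem_smul_pointwise_iff_exists]

lemma ker_le_approx : LinearMap.ker π ≤ approx π := fun k hk =>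
  (mem_approx_iff π k).2 ⟨0, by rw [smul_zero, LinearMap.mem_ker.1 hk]⟩

/-- The map q is π divided by y. It has the same kernel as π, and it is onto because it sends yz to
π(z). -/
lemma exists_approx_map (hreg : IsSMulRegular X (root f n)) :
    ∃ q : approx π →ₗ[BranchedCover f n] X, ∀ k, root f n • q k = π k :=
  LinearMap.exists_smul_eq_of_isSMulRegular hreg (π ∘ₗ (approx π).subtype)
    fun k => (mem_approx_iff π k).1 k.2

lemma approx_map_surjective (hreg : IsSMulRegular X (root f n)) (hπ : Function.Surjective π)
    {q : approx π →ₗ[BranchedCover f n] X} (hq : ∀ k, root f n • q k = π k) :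
    Function.Surjective q := by
  intro x
  obtain ⟨z, rfl⟩ := hπ x
  refine ⟨⟨root f n • z, (mem_approx_iff π _).2 ⟨π z, (map_smul π _ _).symm⟩⟩, hreg ?_⟩
  simp only
  rw [hq, map_smul]

lemma exact_approx (hreg : IsSMulRegular X (root f n))
    {q : approx π →ₗ[BranchedCover f n] X} (hq : ∀ k, root f n • q k = π k) :
    Function.Exact (Submodule.inclusion (ker_le_approx π)) q := by
  intro k
  constructor
  · intro hk
    have h := hq k
    rw [hk, smul_zero] at h
    exact ⟨⟨k, h.symm⟩, rfl⟩
  · rintro ⟨l, rfl⟩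
    apply hreg
    simp only
    rw [hq, smul_zero]
    exact l.2

/-- Since y kills M, it maps P into the syzygy; thus multiplication by y on the syzygy factors
through the projective module P. -/
lemma exists_root_smul_eq (hip : Function.Exact i p) (hi : Function.Injective i) :
    ∃ r : P →ₗ[BranchedCover f n] Mt, (∀ x, i (r x) = root f n • x) ∧
      ∀ z, r (i z) = root f n • z := by
  obtain ⟨r, hr⟩ := LinearMap.exists_comp_eq_of_injective i hi
    (LinearMap.lsmul (BranchedCover f n) P (root f n)) (fun x => (hip _).1 (by
      rw [LinearMap.lsmul_apply, map_smul, root_smul_restrictScalars]))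
  exact ⟨r, hr, fun z => hi (by rw [hr, LinearMap.lsmul_apply, map_smul])⟩

/-- Maps from the syzygy lift along the approximation. -/
lemma exists_lift_approx [Module.Projective (BranchedCover f n) P]
    (hip : Function.Exact i p) (hi : Function.Injective i)
    (hreg : IsSMulRegular X (root f n)) (hπ : Function.Surjective π)
    {q : approx π →ₗ[BranchedCover f n] X} (hq : ∀ k, root f n • q k = π k)
    (φ : Mt →ₗ[BranchedCover f n] X) :
    ∃ φ' : Mt →ₗ[BranchedCover f n] approx π, q ∘ₗ φ' = φ := by
  obtain ⟨r, hr, hr'⟩ := exists_root_smul_eq hip hi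
  -- Here yφ = φ ∘ r ∘ i factors through P and therefore lifts to F; dividing by y makes h ∘ i a
  -- lift of φ along q.
  obtain ⟨h, hh⟩ := Module.projective_lifting_property π (φ ∘ₗ r) hπ
  have hh' : ∀ z, π (h (i z)) = root f n • φ z := fun z => by
    have h1 := LinearMap.congr_fun hh (i z)
    rw [LinearMap.comp_apply, LinearMap.comp_apply, hr', map_smul] at h1
    exact h1
  refine ⟨(h ∘ₗ i).codRestrict (approx π) fun z => (mem_approx_iff π _).2 ⟨φ z, (hh' z).symm⟩,
    LinearMap.ext fun z => hreg ?_⟩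
  simp only [LinearMap.comp_apply]
  rw [hq, ← hh' z]
  rfl

/-- Maps to the syzygy extend along the approximation. -/
lemma exists_extend_approx [Module.Finite (BranchedCover f n) P]
    [Module.Projective (BranchedCover f n) P]
    (hip : Function.Exact i p) (hi : Function.Injective i)
    (hX : MCM (BranchedCover f n) (ModuleCat.of _ X)) (hπ : Function.Surjective π)
    (ψ : LinearMap.ker π →ₗ[BranchedCover f n] Mt) :
    ∃ ψ' : approx π →ₗ[BranchedCover f n] Mt,
      ψ' ∘ₗ Submodule.inclusion (ker_le_approx π) = ψ := by
  have : Module.Free (BranchedCover f n) P := Module.free_of_flat_of_isLocalRing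
  let e := (Module.finBasis (BranchedCover f n) P).equivFun
  obtain ⟨g, hg⟩ := exists_extension hX π hπ (e.toLinearMap ∘ₗ i ∘ₗ ψ)
  have hg' : ∀ x : LinearMap.ker π, e.symm (g x) = i (ψ x) := fun x => by
    rw [hg, LinearMap.comp_apply, LinearMap.comp_apply, LinearEquiv.coe_coe,
      LinearEquiv.symm_apply_apply]
  -- An element of the approximation is a kernel element plus some yz; the extension of ψ to F sends
  -- the former into the syzygy by construction and the latter because yP lies there.
  obtain ⟨ψ', hψ'⟩ := LinearMap.exists_comp_eq_of_injective i hi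
    (e.symm.toLinearMap ∘ₗ g ∘ₗ (approx π).subtype) (fun k => by
      obtain ⟨x, hx⟩ := (mem_approx_iff π _).1 k.2
      obtain ⟨z, rfl⟩ := hπ x
      have hmem : (k : Fin m → BranchedCover f n) - root f n • z ∈ LinearMap.ker π := by
        rw [LinearMap.mem_ker, map_sub, map_smul, hx, sub_self]
      have hk : (k : Fin m → BranchedCover f n) = (k - root f n • z) + root f n • z := by abel
      refine (hip _).1 ?_
      simp only [LinearMap.comp_apply, Submodule.coe_subtype, LinearEquiv.coe_coe]
      rw [hk, map_add, map_add, map_add, hg' ⟨_, hmem⟩, hip.apply_apply_eq_zero, zero_add,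
        map_smul, map_smul, map_smul, root_smul_restrictScalars])
  refine ⟨ψ', LinearMap.ext fun x => hi ?_⟩
  rw [LinearMap.comp_apply, hψ', ← hg']
  rfl

/-- The middle term of the approximation lies in the additive closure of the syzygy. -/
lemma isAddRetract_approx [Module.Projective (BranchedCover f n) P]
    (hf : f ≠ 0) (hM : IsRepresentationGenerator M)
    (hip : Function.Exact i p) (hi : Function.Injective i) (hp : Function.Surjective p)
    (hX : MCM (BranchedCover f n) (ModuleCat.of _ X)) (hπ : Function.Surjective π)
    {a : Mt →ₗ[BranchedCover f n] BranchedCover f n} {b : Mt} (hab : a b = 1) :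
    IsAddRetract (BranchedCover f n) (approx π) Mt := by
  obtain ⟨ι, _, α, β, hαβ⟩ := isAddRetract_quotSMulTop hf hM hX
  let t : (Fin m → BranchedCover f n) →ₗ[BranchedCover f n] QuotSMulTop (root f n) X :=
    Submodule.mkQ _ ∘ₗ π
  have ht : Function.Surjective t := (Submodule.mkQ_surjective _).comp hπ
  have hker : ∀ k, t k = 0 ↔ k ∈ approx π := fun k => Submodule.Quotient.mk_eq_zero _
  choose α₁ hα₁ using fun j => Module.projective_lifting_property p (α j ∘ₗ t) hp
  choose β₁ hβ₁ using fun j => Module.projective_lifting_property t (β j ∘ₗ p) ht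
  have hα₁' : ∀ j x, p (α₁ j x) = α j (t x) := fun j x => LinearMap.congr_fun (hα₁ j) x
  have hβ₁' : ∀ j x, t (β₁ j x) = β j (p x) := fun j x => LinearMap.congr_fun (hβ₁ j) x
  -- The error of the lifted comparison maps between F and P. It carries all of F into the
  -- approximation, so its restriction there factors through F, whose m rank-one summands are
  -- retracts of the syzygy via a and b.
  let h : (Fin m → BranchedCover f n) →ₗ[BranchedCover f n] (Fin m → BranchedCover f n) :=
    LinearMap.id - ∑ j, β₁ j ∘ₗ α₁ j
  have hh : ∀ x, h x ∈ approx π := fun x => by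
    rw [← hker]
    simp only [h, LinearMap.sub_apply, LinearMap.id_apply, LinearMap.sum_apply,
      LinearMap.comp_apply, map_sub, map_sum, hβ₁', hα₁', hαβ, sub_self]
  choose α₂ hα₂ using fun j => LinearMap.exists_comp_eq_of_injective i hi
    (α₁ j ∘ₗ (approx π).subtype) (fun k => (hip _).1 (by
      rw [LinearMap.comp_apply, hα₁', Submodule.coe_subtype, (hker _).2 k.2, map_zero]))
  let β₂ : ι → (Mt →ₗ[BranchedCover f n] approx π) := fun j =>
    (β₁ j ∘ₗ i).codRestrict (approx π) fun z => (hker _).1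
      ((hβ₁' j (i z)).trans (by rw [hip.apply_apply_eq_zero, map_zero]))
  let α₃ : Fin m → (approx π →ₗ[BranchedCover f n] Mt) := fun c =>
    LinearMap.toSpanSingleton _ Mt b ∘ₗ LinearMap.proj c ∘ₗ (approx π).subtype
  let β₃ : Fin m → (Mt →ₗ[BranchedCover f n] approx π) := fun c =>
    LinearMap.toSpanSingleton _ _ ⟨h (Pi.single c 1), hh _⟩ ∘ₗ a
  refine ⟨ι ⊕ Fin m, inferInstance, Sum.elim α₂ α₃, Sum.elim β₂ β₃, fun k => ?_⟩
  rw [Fintype.sum_sum_type]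
  apply Subtype.ext
  have h2 : ∀ j, ((β₂ j (α₂ j k) : approx π) : Fin m → BranchedCover f n) = β₁ j (α₁ j k) :=
    fun j => congrArg (β₁ j) (hα₂ j k)
  have h3 : ∀ c, ((β₃ c (α₃ c k) : approx π) : Fin m → BranchedCover f n) =
      (k : Fin m → BranchedCover f n) c • h (Pi.single c 1) := fun c => by
    simp [β₃, α₃, hab]
  have h4 : ∑ c, (k : Fin m → BranchedCover f n) c • h (Pi.single c 1) = h k := by
    conv_rhs => rw [pi_eq_sum_univ' (k : Fin m → BranchedCover f n)]
    rw [map_sum]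
    refine Finset.sum_congr rfl fun c _ => ?_
    rw [map_smul]
  simp only [Sum.elim_inl, Sum.elim_inr, Submodule.coe_add, Submodule.coe_sum, h2, h3, h4]
  simp [h]

end Approximation

end BranchedCover

/-- A relation that can be continued in both directions has sequences indexed by the integers. -/
lemma exists_int_sequence {α : Type*} (r : α → α → Prop) (h₁ : ∀ x, ∃ y, r y x)
    (h₂ : ∀ x, ∃ y, r x y) (x : α) : ∃ s : ℤ → α, s 0 = x ∧ ∀ i, r (s (i + 1)) (s i) := by
  choose g hg using h₁
  choose h hh using h₂
  refine ⟨fun i => match i with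
    | Int.ofNat k => g^[k] x
    | Int.negSucc k => h^[k + 1] x, rfl, fun i => ?_⟩
  match i with
  | Int.ofNat k =>
    change r (g^[k + 1] x) (g^[k] x)
    rw [Function.iterate_succ_apply']
    exact hg _
  | Int.negSucc 0 => exact hh x
  | Int.negSucc (k + 1) =>
    change r (h^[k + 1] x) (h^[k + 1 + 1] x)
    rw [Function.iterate_succ_apply' h (k + 1)]
    exact hh _

/-! ### The functor Hom(Mt, -): full faithfulness and complete resolutions. -/

section HomFunctor

variable {A : Type u} [CommRing A] (Mt : ModuleCat.{u} A)

/-- `Hom(M, M)` is the regular module. -/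
def homFunctorObjSelf : (homFunctor Mt).obj Mt ≃ₗ[RightEnd Mt] RightEnd Mt where
  toFun φ := MulOpposite.op (φ : Mt ⟶ Mt)
  invFun c := (c.unop : Mt ⟶ Mt)
  map_add' _ _ := rfl
  map_smul' _ _ := rfl
  left_inv _ := rfl
  right_inv _ := rfl

variable {Mt}

/-- The value of `Hom(M, -)` on a direct summand of a finite sum of copies of `M` is finitely
generated projective. -/
lemma IsAddRetract.projective_homFunctor {K : ModuleCat.{u} A} (h : IsAddRetract A K Mt) :
    Module.Projective (RightEnd Mt) ((homFunctor Mt).obj K) ∧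
      Module.Finite (RightEnd Mt) ((homFunctor Mt).obj K) := by
  obtain ⟨ι, _, α, β, hαβ⟩ := h
  let s : (homFunctor Mt).obj K →ₗ[RightEnd Mt] (ι → RightEnd Mt) :=
    LinearMap.pi fun j => (homFunctorObjSelf Mt).toLinearMap ∘ₗ
      ((homFunctor Mt).map (ModuleCat.ofHom (α j))).hom
  let r : (ι → RightEnd Mt) →ₗ[RightEnd Mt] (homFunctor Mt).obj K :=
    ∑ j, ((homFunctor Mt).map (ModuleCat.ofHom (β j))).hom ∘ₗ
      (homFunctorObjSelf Mt).symm.toLinearMap ∘ₗ LinearMap.proj j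
  have hrs : r ∘ₗ s = LinearMap.id := by
    ext φ
    have h1 : r (s φ) = ∑ j, (((φ : Mt ⟶ K) ≫ ModuleCat.ofHom (α j)) ≫ ModuleCat.ofHom (β j) :
        Mt ⟶ K) := by
      simp only [r, LinearMap.sum_apply]
      rfl
    rw [LinearMap.comp_apply, h1, LinearMap.id_apply]
    refine ModuleCat.hom_ext (LinearMap.ext fun z => ?_)
    rw [ModuleCat.hom_sum, LinearMap.sum_apply]
    exact hαβ ((φ : Mt ⟶ K).hom z)
  exact ⟨Module.Projective.of_split s r hrs, Module.Finite.of_surjective r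
    fun φ => ⟨s φ, LinearMap.congr_fun hrs φ⟩⟩

/-- `Hom(M, -)` is full if the ring is a direct summand of `M`. -/
lemma homFunctor_linearMap_eq {a : Mt →ₗ[A] A} {b : Mt} (hab : a b = 1) {X Y : ModuleCat.{u} A}
    (T : (homFunctor Mt).obj X →ₗ[RightEnd Mt] (homFunctor Mt).obj Y) :
    ∃ g : X ⟶ Y, T = ((homFunctor Mt).map g).hom := by
  let c : ∀ {Z : ModuleCat.{u} A}, Z → (Mt ⟶ Z) := fun {Z} z =>
    ModuleCat.ofHom (LinearMap.toSpanSingleton A Z z ∘ₗ a)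
  have hc : ∀ {Z : ModuleCat.{u} A} (z : Z) (w : Mt), (c z).hom w = a w • z := fun z w => rfl
  obtain ⟨t, ht⟩ : ∃ t : (Mt ⟶ X) → (Mt ⟶ Y), ∀ φ, t φ = T φ := ⟨fun φ => T φ, fun _ => rfl⟩
  have hcomp : ∀ (e : Mt ⟶ Mt) (φ : Mt ⟶ X), t (e ≫ φ) = e ≫ t φ := fun e φ => by
    rw [ht, ht]
    exact T.map_smul (MulOpposite.op e : RightEnd Mt) φ
  have hadd : ∀ φ ψ : Mt ⟶ X, t (φ + ψ) = t φ + t ψ := fun φ ψ => by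
    rw [ht, ht, ht]
    exact T.map_add φ ψ
  let g : X →ₗ[A] Y :=
    { toFun := fun x => (t (c x)).hom b
      map_add' := fun x y => by
        have h : c (x + y) = (c x + c y : Mt ⟶ X) := by
          refine ModuleCat.hom_ext (LinearMap.ext fun w => ?_)
          rw [hc, ModuleCat.hom_add, LinearMap.add_apply, hc, hc, smul_add]
        rw [h, hadd, ModuleCat.hom_add, LinearMap.add_apply]
      map_smul' := fun q x => by
        -- Scalars of A act through Λ, so Λ-linearity of T gives A-linearity of g.
        have h : c (q • x) = ModuleCat.ofHom (q • LinearMap.id : Mt →ₗ[A] Mt) ≫ c x := by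
          refine ModuleCat.hom_ext (LinearMap.ext fun w => ?_)
          rw [hc, ModuleCat.hom_comp, LinearMap.comp_apply, hc, ModuleCat.hom_ofHom,
            LinearMap.smul_apply, LinearMap.id_apply, map_smul, smul_eq_mul, mul_comm, mul_smul]
        rw [h, hcomp, ModuleCat.hom_comp, LinearMap.comp_apply]
        simp }
  have key : ∀ φ : Mt ⟶ X, t φ = φ ≫ ModuleCat.ofHom g := fun φ => by
    refine ModuleCat.hom_ext (LinearMap.ext fun w => ?_)
    -- Precomposing φ with the rank-one endomorphism c w and evaluating at b reduces the value of T
    -- φ at w to the definition of g.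
    have h : c w ≫ φ = c (φ.hom w) := by
      refine ModuleCat.hom_ext (LinearMap.ext fun v => ?_)
      rw [ModuleCat.hom_comp, LinearMap.comp_apply, hc, hc, map_smul]
    change (t φ).hom w = (t (c (φ.hom w))).hom b
    rw [← h, hcomp, ModuleCat.hom_comp, LinearMap.comp_apply, hc, hab, one_smul]
  exact ⟨ModuleCat.ofHom g, LinearMap.ext fun φ => (ht φ).symm.trans (key φ)⟩

lemma homFunctor_map_injective {a : Mt →ₗ[A] A} {b : Mt} (hab : a b = 1) {X Y : ModuleCat.{u} A}
    {g h : X ⟶ Y} (hgh : (homFunctor Mt).map g = (homFunctor Mt).map h) : g = h := by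
  refine ModuleCat.hom_ext (LinearMap.ext fun x => ?_)
  let c : Mt ⟶ X := ModuleCat.ofHom (LinearMap.toSpanSingleton A X x ∘ₗ a)
  have hc : c.hom b = x := by
    change a b • x = x
    rw [hab, one_smul]
  have h1 : c ≫ g = c ≫ h := congrArg (fun T => (T.hom c : Mt ⟶ Y)) hgh
  have h2 := congrArg (fun φ : Mt ⟶ Y => φ.hom b) h1
  simpa [hc] using h2

variable (Mt) in
/-- A short exact sequence `0 → L → K → X → 0` with `K` in `add M` that stays exact under
`Hom(M, -)` and `Hom(-, M)`. -/
def IsAddApproximation (L X : ModuleCat.{u} A) : Prop :=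
  ∃ (K : ModuleCat.{u} A) (j : L →ₗ[A] K) (q : K →ₗ[A] X), Function.Injective j ∧
    Function.Exact j q ∧ Function.Surjective q ∧ IsAddRetract A K Mt ∧
    (∀ φ : Mt →ₗ[A] X, ∃ φ' : Mt →ₗ[A] K, q ∘ₗ φ' = φ) ∧
    (∀ ψ : L →ₗ[A] Mt, ∃ ψ' : K →ₗ[A] Mt, ψ' ∘ₗ j = ψ)

/-- Splicing approximations gives a complete resolution. -/
lemma gp_homFunctor {a : Mt →ₗ[A] A} {b : Mt} (hab : a b = 1) (N : ℤ → ModuleCat.{u} A)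
    (hN : ∀ i, IsAddApproximation Mt (N (i + 1)) (N i)) :
    GP (RightEnd Mt) ((homFunctor Mt).obj (N (0 + 1))) := by
  choose K j q hj hjq hq hK hlift hext using hN
  have hlift' : ∀ i (φ : Mt ⟶ N i), ∃ φ' : Mt ⟶ K i, φ' ≫ ModuleCat.ofHom (q i) = φ := by
    intro i φ
    obtain ⟨φ', h⟩ := hlift i φ.hom
    exact ⟨ModuleCat.ofHom φ', ModuleCat.hom_ext h⟩
  let δ : ∀ i, K (i + 1) ⟶ K i := fun i => ModuleCat.ofHom (j i ∘ₗ q (i + 1))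
  have hker : ∀ i (φ : Mt ⟶ K (i + 1)), φ ≫ ModuleCat.ofHom (q (i + 1)) = 0 →
      ∃ φ' : Mt ⟶ K (i + 1 + 1), φ' ≫ δ (i + 1) = φ := by
    intro i φ h
    obtain ⟨χ, hχ⟩ := LinearMap.exists_comp_eq_of_injective (j (i + 1)) (hj (i + 1)) φ.hom
      fun w => (hjq (i + 1) _).1 (congrArg (fun g : Mt ⟶ N (i + 1) => g.hom w) h)
    obtain ⟨φ', hφ'⟩ := hlift' (i + 1 + 1) (ModuleCat.ofHom χ)
    refine ⟨φ', ModuleCat.hom_ext (LinearMap.ext fun w => ?_)⟩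
    rw [← hχ]
    exact congrArg (j (i + 1)) (congrArg (fun g : Mt ⟶ N (i + 1 + 1) => g.hom w) hφ')
  refine ⟨?_, ⟨?_⟩⟩
  · have := (hK (0 + 1)).projective_homFunctor.2
    exact Module.Finite.of_surjective ((homFunctor Mt).map (ModuleCat.ofHom (q (0 + 1)))).hom
      fun φ => hlift' _ φ
  have hιinj : Function.Injective ((homFunctor Mt).map (ModuleCat.ofHom (j 0))).hom := by
    intro φ ψ h
    refine ModuleCat.hom_ext (LinearMap.ext fun w => hj 0 ?_)
    exact congrArg (fun g : Mt ⟶ K 0 => g.hom w) h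
  have hrange : LinearMap.range ((homFunctor Mt).map (δ 0)).hom =
      LinearMap.range ((homFunctor Mt).map (ModuleCat.ofHom (j 0))).hom := by
    apply le_antisymm
    · rintro _ ⟨φ, rfl⟩
      exact ⟨((homFunctor Mt).map (ModuleCat.ofHom (q (0 + 1)))).hom φ, rfl⟩
    · rintro _ ⟨φ, rfl⟩
      obtain ⟨φ', hφ'⟩ := hlift' (0 + 1) φ
      refine ⟨φ', ?_⟩
      rw [← hφ']
      rfl
  exact
    { P := fun i => (homFunctor Mt).obj (K i)
      d := fun i => ((homFunctor Mt).map (δ i)).hom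
      projective := fun i => (hK i).projective_homFunctor.1
      exact := fun i φ => by
        constructor
        · intro h
          refine hker i φ (ModuleCat.hom_ext (LinearMap.ext fun w => hj i ?_))
          rw [ModuleCat.hom_zero, LinearMap.zero_apply, map_zero]
          exact congrArg (fun g : Mt ⟶ K i => g.hom w) h
        · rintro ⟨φ', rfl⟩
          refine ModuleCat.hom_ext (LinearMap.ext fun w => ?_)
          change j i (q (i + 1) (j (i + 1) _)) = 0
          rw [(hjq (i + 1)).apply_apply_eq_zero, map_zero]
      exact_hom := fun i T => by
        -- As Λ = Hom(Mt, Mt), fullness identifies the Λ-dual of Hom(Mt, X) with Hom(X, Mt).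
        -- Exactness of the dual complex becomes extension of maps into Mt along the approximations.
        have hself : ∀ {X : ModuleCat.{u} A} (T : (homFunctor Mt).obj X →ₗ[RightEnd Mt] RightEnd Mt),
            ∃ g : X ⟶ Mt, T = (homFunctorObjSelf Mt).toLinearMap ∘ₗ ((homFunctor Mt).map g).hom := by
          intro X T
          obtain ⟨g, hg⟩ := homFunctor_linearMap_eq hab
            ((homFunctorObjSelf Mt).symm.toLinearMap ∘ₗ T)
          exact ⟨g, by rw [← hg]; rfl⟩
        constructor
        · intro h
          obtain ⟨g, rfl⟩ := hself T
          have h1 : δ (i + 1) ≫ g = 0 := by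
            refine homFunctor_map_injective hab (ModuleCat.hom_ext (LinearMap.ext fun φ => ?_))
            have h2 := LinearMap.congr_fun h φ
            refine (homFunctorObjSelf Mt).injective ?_
            rw [Functor.map_comp, Functor.map_zero, ModuleCat.hom_zero, LinearMap.zero_apply, map_zero]
            exact h2
          have h3 : ∀ x, g.hom (j (i + 1) x) = 0 := fun x => by
            obtain ⟨z, rfl⟩ := hq (i + 1 + 1) x
            exact congrArg (fun g : K (i + 1 + 1) ⟶ Mt => g.hom z) h1
          obtain ⟨χ, hχ⟩ : ∃ χ : N (i + 1) →ₗ[A] Mt, χ ∘ₗ q (i + 1) = g.hom := by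
            have hle : LinearMap.ker (q (i + 1)) ≤ LinearMap.ker g.hom := fun z hz => by
              obtain ⟨x, rfl⟩ := (hjq (i + 1) z).1 hz
              exact h3 x
            refine ⟨(LinearMap.ker (q (i + 1))).liftQ g.hom hle ∘ₗ
              ((q (i + 1)).quotKerEquivOfSurjective (hq (i + 1))).symm.toLinearMap,
              LinearMap.ext fun z => ?_⟩
            rw [LinearMap.comp_apply, LinearMap.comp_apply, LinearEquiv.coe_coe]
            have h4 : ((q (i + 1)).quotKerEquivOfSurjective (hq (i + 1))).symm (q (i + 1) z) =
                Submodule.Quotient.mk z := by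
              rw [LinearEquiv.symm_apply_eq]
              rfl
            rw [h4]
            rfl
          obtain ⟨g', hg'⟩ := hext i χ
          refine ⟨(homFunctorObjSelf Mt).toLinearMap ∘ₗ
            ((homFunctor Mt).map (ModuleCat.ofHom g')).hom, LinearMap.ext fun φ => ?_⟩
          have h5 : δ i ≫ ModuleCat.ofHom g' = g := by
            refine ModuleCat.hom_ext ?_
            rw [← hχ, ← hg']
            rfl
          rw [← h5, Functor.map_comp]
          rfl
        · rintro ⟨T', rfl⟩
          refine LinearMap.ext fun φ => ?_
          have h6 : ((homFunctor Mt).map (δ i)).hom (((homFunctor Mt).map (δ (i + 1))).hom φ) = 0 := by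
            refine ModuleCat.hom_ext (LinearMap.ext fun w => ?_)
            change j i (q (i + 1) (j (i + 1) _)) = 0
            rw [(hjq (i + 1)).apply_apply_eq_zero, map_zero]
          change T' (((homFunctor Mt).map (δ i)).hom (((homFunctor Mt).map (δ (i + 1))).hom φ)) = 0
          rw [h6, map_zero]
      iso := (LinearEquiv.ofInjective _ hιinj).trans (LinearEquiv.ofEq _ _ hrange.symm) }

end HomFunctor

/-! ### The idempotent of Λ cutting out the ring, and recovery of a module from its corner. -/

section Corner

variable {A : Type u} [CommRing A] {Mt : ModuleCat.{u} A}

/-- The endomorphism `w ↦ a(w) z` of `M`, as an element of the opposite ring. -/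
def rankOne (a : Mt →ₗ[A] A) : Mt →ₗ[A] RightEnd Mt where
  toFun z := MulOpposite.op (ModuleCat.ofHom (LinearMap.toSpanSingleton A Mt z ∘ₗ a) : End Mt)
  map_add' y z := MulOpposite.unop_injective
    (ModuleCat.hom_ext (LinearMap.ext fun w => smul_add (a w) y z))
  map_smul' q z := MulOpposite.unop_injective
    (ModuleCat.hom_ext (LinearMap.ext fun w => smul_comm (a w) q z))

/-- Evaluation of endomorphisms of `M` at an element. -/
def evalAt (b : Mt) : RightEnd Mt →ₗ[A] Mt where
  toFun c := (c.unop : Mt ⟶ Mt).hom b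
  map_add' _ _ := rfl
  map_smul' _ _ := rfl

lemma evalAt_rankOne (a : Mt →ₗ[A] A) (b z : Mt) : evalAt b (rankOne a z) = a b • z := rfl

/-- In the opposite ring c is applied last. With a(b) = 1 it follows that e = `rankOne a b` is
idempotent and that z ↦ `rankOne a z` identifies Mt with eΛ. -/
lemma rankOne_mul (a : Mt →ₗ[A] A) (z : Mt) (c : RightEnd Mt) :
    rankOne a z * c = rankOne a (evalAt z c) :=
  MulOpposite.unop_injective
    (ModuleCat.hom_ext (LinearMap.ext fun w => map_smul (c.unop : Mt ⟶ Mt).hom (a w) z))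

lemma RightEnd.ext_evalAt {c d : RightEnd Mt} (h : ∀ z, evalAt z c = evalAt z d) : c = d :=
  MulOpposite.unop_injective (ModuleCat.hom_ext (LinearMap.ext h))

variable {a : Mt →ₗ[A] A} {b : Mt}

section Projective

variable {P : Type u} [AddCommGroup P] [Module (RightEnd Mt) P] [Module.Projective (RightEnd Mt) P]

/-- P embeds in a free module, and a coordinate c ∈ Λ with `rankOne a z * c = 0` satisfies c(z) = 0,
as evaluation at b shows. -/
lemma eq_zero_of_rankOne_smul_eq_zero (hab : a b = 1) {x : P} (hx : ∀ z, rankOne a z • x = 0) :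
    x = 0 := by
  obtain ⟨σ, hσ⟩ := Module.projective_def.1 ‹Module.Projective (RightEnd Mt) P›
  have h : σ x = 0 := by
    ext p
    refine RightEnd.ext_evalAt fun z => ?_
    have h1 : rankOne a z * σ x p = 0 := by
      have h2 := congrArg (fun v => v p) (congrArg σ (hx z))
      simpa using h2
    rw [rankOne_mul] at h1
    have h3 := congrArg (evalAt b) h1
    rw [evalAt_rankOne, hab, one_smul, map_zero] at h3
    rw [h3]
    exact (map_zero (evalAt z)).symm
  rw [← hσ x, h, map_zero]

variable [Module A P] [IsScalarTower A (RightEnd Mt) P]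

/-- The image of the idempotent `w ↦ a(w) b`. -/
def corner (a : Mt →ₗ[A] A) (b : Mt) (P : Type u) [AddCommGroup P] [Module (RightEnd Mt) P] [Module A P]
    [IsScalarTower A (RightEnd Mt) P] : Submodule A P where
  carrier := {x | rankOne a b • x = x}
  add_mem' {x y} hx hy := by
    simp only [Set.mem_ofPred_eq] at hx hy ⊢
    rw [smul_add, hx, hy]
  zero_mem' := smul_zero _
  smul_mem' q x hx := by
    simp only [Set.mem_ofPred_eq] at hx ⊢
    rw [smul_comm, hx]

lemma mem_corner_iff {P : Type u} [AddCommGroup P] [Module (RightEnd Mt) P] [Module A P]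
    [IsScalarTower A (RightEnd Mt) P] {x : P} : x ∈ corner a b P ↔ rankOne a b • x = x := Iff.rfl

lemma rankOne_smul_mem_corner (hab : a b = 1) {P : Type u} [AddCommGroup P]
    [Module (RightEnd Mt) P] [Module A P] [IsScalarTower A (RightEnd Mt) P] (z : Mt) (x : P) :
    rankOne a z • x ∈ corner a b P := by
  rw [mem_corner_iff, ← mul_smul, rankOne_mul, evalAt_rankOne, hab, one_smul]

/-- P is a retract of the free module on its own elements; applying e replaces each copy of Λ by eΛ
≅ Mt. -/
lemma exists_corner_retract (hab : a b = 1) : ∃ (s : corner a b P →ₗ[A] (P →₀ Mt))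
    (r : (P →₀ Mt) →ₗ[A] corner a b P), (∀ x, r (s x) = x) ∧
      ∀ v, (r v : P) = v.sum fun p z => rankOne a z • p := by
  obtain ⟨σ, hσ⟩ := Module.projective_def.1 ‹Module.Projective (RightEnd Mt) P›
  let s : corner a b P →ₗ[A] (P →₀ Mt) := Finsupp.mapRange.linearMap (evalAt b) ∘ₗ
    σ.restrictScalars A ∘ₗ (corner a b P).subtype
  let r₀ : (P →₀ Mt) →ₗ[A] P := Finsupp.lsum A fun p =>
    (LinearMap.toSpanSingleton (RightEnd Mt) P p).restrictScalars A ∘ₗ rankOne a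
  have hr₀ : ∀ v, r₀ v = v.sum fun p z => rankOne a z • p := fun v => rfl
  have hmem : ∀ v, r₀ v ∈ corner a b P := fun v => by
    rw [hr₀]
    exact Submodule.sum_mem _ fun p _ => rankOne_smul_mem_corner hab _ _
  refine ⟨s, r₀.codRestrict _ hmem, fun x => Subtype.ext ?_, fun v => rfl⟩
  change r₀ (s x) = x
  rw [hr₀]
  change (Finsupp.mapRange (evalAt b) (map_zero (evalAt b)) (σ (x : P))).sum
    (fun p z => rankOne a z • p) = (x : P)
  rw [Finsupp.sum_mapRange_index fun p => by rw [map_zero, zero_smul]]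
  have h : ∀ (p : P) (c : RightEnd Mt),
      rankOne a (evalAt b c) • p = rankOne a b • c • p := fun p c => by
    rw [← rankOne_mul, mul_smul]
  simp_rw [h]
  rw [← Finsupp.smul_sum]
  have h2 := hσ x
  rw [Finsupp.linearCombination_apply] at h2
  exact (congrArg (rankOne a b • ·) h2).trans x.2

/-- This is surjectivity of P → Hom(Mt, eP). Finite generation of Mt puts all the values of s ∘ h in
one finite support, even if P is not finitely generated; each coordinate is then an endomorphism of
Mt. -/
lemma exists_rankOne_smul_eq (hab : a b = 1) [Module.Finite A Mt] (h : Mt →ₗ[A] corner a b P) :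
    ∃ x : P, ∀ z, rankOne a z • x = h z := by
  classical
  obtain ⟨s, r, hrs, hr⟩ := exists_corner_retract (P := P) hab
  obtain ⟨G, hG⟩ := Module.Finite.fg_top (R := A) (M := Mt)
  let T : Finset P := G.biUnion fun z => (s (h z)).support
  have hT : ∀ z, (s (h z)).support ⊆ T := by
    have hle : (⊤ : Submodule A Mt) ≤ (Finsupp.supported Mt A (T : Set P)).comap (s ∘ₗ h) := by
      rw [← hG, Submodule.span_le]
      intro z hz
      exact fun p hp => Finset.mem_biUnion.2 ⟨z, hz, hp⟩
    exact fun z => Finset.coe_subset.1 (hle (Submodule.mem_top (x := z)))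
  let g : P → RightEnd Mt := fun p =>
    MulOpposite.op (ModuleCat.ofHom (Finsupp.lapply p ∘ₗ s ∘ₗ h) : End Mt)
  refine ⟨∑ p ∈ T, g p • p, fun z => ?_⟩
  rw [← hrs (h z), hr, Finsupp.sum_of_support_subset _ (hT z) _ (by simp), Finset.smul_sum]
  refine Finset.sum_congr rfl fun p _ => ?_
  rw [← mul_smul, rankOne_mul]
  rfl

end Projective

variable {X Y : Type u} [AddCommGroup X] [Module (RightEnd Mt) X] [Module A X]
  [IsScalarTower A (RightEnd Mt) X] [AddCommGroup Y] [Module (RightEnd Mt) Y] [Module A Y]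
  [IsScalarTower A (RightEnd Mt) Y]

/-- The map on images of the idempotent. -/
def cornerMap (a : Mt →ₗ[A] A) (b : Mt) (g : X →ₗ[RightEnd Mt] Y) : corner a b X →ₗ[A] corner a b Y :=
  (g.restrictScalars A ∘ₗ (corner a b X).subtype).codRestrict _ fun x => by
    rw [mem_corner_iff, LinearMap.comp_apply, LinearMap.coe_restrictScalars, ← map_smul]
    exact congrArg g x.2

lemma cornerMap_apply (g : X →ₗ[RightEnd Mt] Y) (x : corner a b X) :
    (cornerMap a b g x : Y) = g x := rfl

lemma cornerMap_injective {g : X →ₗ[RightEnd Mt] Y} (hg : Function.Injective g) :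
    Function.Injective (cornerMap a b g) := fun _ _ h =>
  Subtype.ext (hg (congrArg Subtype.val h))

lemma cornerMap_surjective (hab : a b = 1) {g : X →ₗ[RightEnd Mt] Y} (hg : Function.Surjective g) :
    Function.Surjective (cornerMap a b g) := fun y => by
  obtain ⟨x, hx⟩ := hg y
  refine ⟨⟨_, rankOne_smul_mem_corner hab b x⟩, Subtype.ext ?_⟩
  rw [cornerMap_apply, map_smul, hx]
  exact y.2

lemma cornerMap_exact (hab : a b = 1) {Z : Type u} [AddCommGroup Z] [Module (RightEnd Mt) Z]
    [Module A Z] [IsScalarTower A (RightEnd Mt) Z] {g : X →ₗ[RightEnd Mt] Y}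
    {h : Y →ₗ[RightEnd Mt] Z} (hgh : Function.Exact g h) :
    Function.Exact (cornerMap a b g) (cornerMap a b h) := by
  intro y
  constructor
  · intro hy
    obtain ⟨x, hx⟩ := (hgh y).1 (congrArg Subtype.val hy)
    refine ⟨⟨_, rankOne_smul_mem_corner hab b x⟩, Subtype.ext ?_⟩
    rw [cornerMap_apply, map_smul, hx]
    exact y.2
  · rintro ⟨x, rfl⟩
    exact Subtype.ext (hgh.apply_apply_eq_zero x)

variable (X) in
/-- The natural map `X → Hom(M, eX)`. -/
def toHomCorner (hab : a b = 1) :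
    X →ₗ[RightEnd Mt] (homFunctor Mt).obj (ModuleCat.of A (corner a b X)) where
  toFun x := ModuleCat.ofHom (((LinearMap.toSpanSingleton (RightEnd Mt) X x).restrictScalars A ∘ₗ
    rankOne a).codRestrict (corner a b X) fun z => rankOne_smul_mem_corner hab z x)
  map_add' x y := ModuleCat.hom_ext (LinearMap.ext fun z => Subtype.ext (smul_add _ x y))
  map_smul' c x := ModuleCat.hom_ext (LinearMap.ext fun z => Subtype.ext (by
    change rankOne a z • c • x = rankOne a (evalAt z c) • x
    rw [← mul_smul, rankOne_mul]))

/-- X is the kernel of P → P', and a map Mt → eX becomes multiplication on some x₀ ∈ P. The image of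
x₀ in P' is killed by all rank-one elements, hence is zero, so x₀ comes from X. -/
lemma toHomCorner_bijective (hab : a b = 1) [Module.Finite A Mt] {P P' : Type u} [AddCommGroup P]
    [Module (RightEnd Mt) P] [Module A P] [IsScalarTower A (RightEnd Mt) P]
    [Module.Projective (RightEnd Mt) P] [AddCommGroup P'] [Module (RightEnd Mt) P']
    [Module.Projective (RightEnd Mt) P'] {v : X →ₗ[RightEnd Mt] P} {w : P →ₗ[RightEnd Mt] P'}
    (hv : Function.Injective v) (hvw : Function.Exact v w) :
    Function.Bijective (toHomCorner X hab) := by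
  constructor
  · rw [injective_iff_map_eq_zero]
    intro x hx
    apply hv
    rw [map_zero]
    refine eq_zero_of_rankOne_smul_eq_zero hab fun z => ?_
    have h : rankOne a z • x = 0 :=
      congrArg (fun g : Mt ⟶ ModuleCat.of A (corner a b X) => ((g.hom z : corner a b X) : X)) hx
    rw [← map_smul, h, map_zero]
  · intro h
    obtain ⟨h, rfl⟩ : ∃ h' : Mt →ₗ[A] corner a b X, ModuleCat.ofHom h' = h :=
      ⟨(h : Mt ⟶ ModuleCat.of A (corner a b X)).hom, rfl⟩
    obtain ⟨x₀, hx₀⟩ := exists_rankOne_smul_eq hab (cornerMap a b v ∘ₗ h)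
    have hx₀' : ∀ z, rankOne a z • x₀ = v (h z) := hx₀
    obtain ⟨x, rfl⟩ := (hvw x₀).1 (eq_zero_of_rankOne_smul_eq_zero hab fun z => by
      rw [← map_smul, hx₀', hvw.apply_apply_eq_zero])
    refine ⟨x, ModuleCat.hom_ext (LinearMap.ext fun z => Subtype.ext (hv ?_))⟩
    change v (rankOne a z • x) = v (h z)
    rw [map_smul, hx₀']

end Corner

/-! ### MCM modules give Gorenstein projectives, and conversely. -/

namespace BranchedCover

open IsLocalRing

variable {S : Type u} [CommRing S] [IsRegularLocalRing S] {f : maximalIdeal S} {n : ℕ} [NeZero n]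

section Functor

variable {M : ModuleCat.{u} (Hypersurface f)} {Mt P : ModuleCat.{u} (BranchedCover f n)}
  [Module.Finite (BranchedCover f n) P] [Module.Projective (BranchedCover f n) P]
  {i : Mt →ₗ[BranchedCover f n] P}
  {p : P →ₗ[BranchedCover f n] ((ModuleCat.restrictScalars (toHypersurface f n)).obj M)}
  {a : Mt →ₗ[BranchedCover f n] BranchedCover f n} {b : Mt}

/-- The isomorphism `e` lets one statement serve both directions: L as the kernel of a free cover of
X, and L as a given module embedded in a free one with cokernel X. -/
lemma isAddApproximation_of_linearEquiv (hf : f ≠ 0) (hM : IsRepresentationGenerator M)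
    (hip : Function.Exact i p) (hi : Function.Injective i) (hp : Function.Surjective p)
    (hab : a b = 1) {L X : ModuleCat.{u} (BranchedCover f n)} (hX : MCM (BranchedCover f n) X)
    {m : ℕ} {π : (Fin m → BranchedCover f n) →ₗ[BranchedCover f n] X}
    (hπ : Function.Surjective π) (e : L ≃ₗ[BranchedCover f n] LinearMap.ker π) :
    IsAddApproximation Mt L X := by
  have hreg : IsSMulRegular X (root f n) := isSMulRegular_root hf hX
  obtain ⟨q, hq⟩ := exists_approx_map π hreg
  refine ⟨ModuleCat.of _ (approx π), Submodule.inclusion (ker_le_approx π) ∘ₗ e.toLinearMap, q,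
    (Submodule.inclusion_injective (ker_le_approx π)).comp e.injective, fun k => ?_,
    approx_map_surjective π hreg hπ hq, isAddRetract_approx π hf hM hip hi hp hX hπ hab,
    exists_lift_approx π hip hi hreg hπ hq, fun ψ => ?_⟩
  · rw [exact_approx π hreg hq k]
    exact (e.surjective.range_comp _).symm ▸ Iff.rfl
  · obtain ⟨ψ', h⟩ := exists_extend_approx π hip hi hX hπ (ψ ∘ₗ e.symm.toLinearMap)
    refine ⟨ψ', LinearMap.ext fun x => ?_⟩
    have h1 := LinearMap.congr_fun h (e x)
    rwa [LinearMap.comp_apply, LinearMap.comp_apply, LinearEquiv.coe_coe,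
      LinearEquiv.symm_apply_apply] at h1

lemma exists_isAddApproximation_left (hf : f ≠ 0) (hM : IsRepresentationGenerator M)
    (hip : Function.Exact i p) (hi : Function.Injective i) (hp : Function.Surjective p)
    (hab : a b = 1) {X : ModuleCat.{u} (BranchedCover f n)} (hX : MCM (BranchedCover f n) X) :
    ∃ L, MCM (BranchedCover f n) L ∧ IsAddApproximation Mt L X := by
  have := hX.1
  obtain ⟨m, π, hπ⟩ := Module.Finite.exists_fin' (BranchedCover f n) X
  exact ⟨ModuleCat.of _ (LinearMap.ker π), mcm_ker hX (mcm_pi f n m) π hπ,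
    isAddApproximation_of_linearEquiv hf hM hip hi hp hab hX hπ (LinearEquiv.refl _ _)⟩

lemma exists_isAddApproximation_right (hf : f ≠ 0) (hM : IsRepresentationGenerator M)
    (hip : Function.Exact i p) (hi : Function.Injective i) (hp : Function.Surjective p)
    (hab : a b = 1) {X : ModuleCat.{u} (BranchedCover f n)} (hX : MCM (BranchedCover f n) X) :
    ∃ C, MCM (BranchedCover f n) C ∧ IsAddApproximation Mt X C := by
  obtain ⟨m, ι, hι, hC⟩ := exists_mcm_quotient (X := X) hX
  exact ⟨_, hC, isAddApproximation_of_linearEquiv hf hM hip hi hp hab hC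
    (π := (LinearMap.range ι).mkQ) (Submodule.mkQ_surjective _)
    ((LinearEquiv.ofInjective ι hι).trans (LinearEquiv.ofEq _ _ (Submodule.ker_mkQ _).symm))⟩

/-- `Hom(M, -)` sends maximal Cohen-Macaulay modules to Gorenstein projective modules. -/
lemma gp_homFunctor_of_mcm (hf : f ≠ 0) (hM : IsRepresentationGenerator M)
    (hip : Function.Exact i p) (hi : Function.Injective i) (hp : Function.Surjective p)
    (hab : a b = 1) {X : ModuleCat.{u} (BranchedCover f n)} (hX : MCM (BranchedCover f n) X) :
    GP (RightEnd Mt) ((homFunctor Mt).obj X) := by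
  obtain ⟨s, hs, hrel⟩ := exists_int_sequence
    (fun L X : { N // MCM (BranchedCover f n) N } => IsAddApproximation Mt L.1 X.1)
    (fun X => by
      obtain ⟨L, hL, h⟩ := exists_isAddApproximation_left hf hM hip hi hp hab X.2
      exact ⟨⟨L, hL⟩, h⟩)
    (fun X => by
      obtain ⟨C, hC, h⟩ := exists_isAddApproximation_right hf hM hip hi hp hab X.2
      exact ⟨⟨C, hC⟩, h⟩) ⟨X, hX⟩
  -- Splicing resolves the module at index 1, as that is the image of `d 0`; the shift moves X
  -- there.
  have h := gp_homFunctor hab (fun j => (s (j - 1)).1) fun j => by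
    have h1 := hrel (j - 1)
    rwa [show j - 1 + 1 = j + 1 - 1 by ring] at h1
  have h0 : (s (0 + 1 - 1)).1 = X := by
    rw [show (0 + 1 - 1 : ℤ) = 0 from rfl, hs]
  rwa [h0] at h

end Functor

section Converse

variable {Mt : ModuleCat.{u} (BranchedCover f n)}
  {a : Mt →ₗ[BranchedCover f n] BranchedCover f n} {b : Mt}

lemma flat_corner (hMt : MCM (BranchedCover f n) Mt) (hab : a b = 1) (P : Type u) [AddCommGroup P]
    [Module (RightEnd Mt) P] [Module.Projective (RightEnd Mt) P] [Module (BranchedCover f n) P]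
    [IsScalarTower (BranchedCover f n) (RightEnd Mt) P] [Module S (corner a b P)]
    [IsScalarTower S (BranchedCover f n) (corner a b P)] : Module.Flat S (corner a b P) := by
  let := Module.compHom Mt (algebraMap S (BranchedCover f n))
  have : IsScalarTower S (BranchedCover f n) Mt := IsScalarTower.of_compHom _ _ _
  obtain ⟨-, hfree⟩ := (mcm_iff_free f n Mt).1 hMt
  obtain ⟨s, r, hrs, -⟩ := exists_corner_retract (P := P) hab
  exact Module.Flat.of_retract (s.restrictScalars S) (r.restrictScalars S)
    (LinearMap.ext hrs)

lemma isWeaklyRegular_corner (hMt : MCM (BranchedCover f n) Mt) (hab : a b = 1) {rs : List S}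
    (hrs : ∀ (X : Type u) [AddCommGroup X] [Module S X] [Module.Flat S X],
      RingTheory.Sequence.IsWeaklyRegular X rs) (P : Type u) [AddCommGroup P]
    [Module (RightEnd Mt) P] [Module.Projective (RightEnd Mt) P] [Module (BranchedCover f n) P]
    [IsScalarTower (BranchedCover f n) (RightEnd Mt) P] :
    RingTheory.Sequence.IsWeaklyRegular (corner a b P)
      (rs.map (algebraMap S (BranchedCover f n))) := by
  let := Module.compHom (corner a b P) (algebraMap S (BranchedCover f n))
  have : IsScalarTower S (BranchedCover f n) (corner a b P) := IsScalarTower.of_compHom _ _ _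
  have := flat_corner hMt hab P
  exact (RingTheory.Sequence.isWeaklyRegular_map_algebraMap_iff _ _ _).2 (hrs _)

lemma finite_rightEnd (hMt : MCM (BranchedCover f n) Mt) :
    Module.Finite (BranchedCover f n) (RightEnd Mt) := by
  have := hMt.1
  let t : RightEnd Mt →ₗ[BranchedCover f n] (Mt →ₗ[BranchedCover f n] Mt) :=
    { toFun := fun c => (c.unop : Mt ⟶ Mt).hom
      map_add' := fun _ _ => rfl
      map_smul' := fun _ _ => rfl }
  exact Module.Finite.of_injective t fun c d h => MulOpposite.unop_injective (ModuleCat.hom_ext h)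

/-- A Gorenstein projective module is `Hom(M, N)` for a maximal Cohen-Macaulay module `N`. -/
lemma exists_mcm_of_gp (hMt : MCM (BranchedCover f n) Mt) (hab : a b = 1)
    {X : ModuleCat.{u} (RightEnd Mt)} (hX : GP (RightEnd Mt) X) :
    ∃ N : ModuleCat.{u} (BranchedCover f n), MCM (BranchedCover f n) N ∧
      Nonempty (X ≅ (homFunctor Mt).obj N) := by
  obtain ⟨hfin, ⟨P, d, hproj, hexact, -, e⟩⟩ := hX
  have := hMt.1
  have := finite_rightEnd hMt
  let modP : ∀ j, Module (BranchedCover f n) (P j) := fun j =>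
    Module.compHom (P j) (algebraMap (BranchedCover f n) (RightEnd Mt))
  have towP : ∀ j, IsScalarTower (BranchedCover f n) (RightEnd Mt) (P j) := fun j =>
    IsScalarTower.of_compHom _ _ _
  let Z : ∀ j : ℤ, Submodule (RightEnd Mt) (P j) := fun j => LinearMap.range (d j)
  obtain ⟨D, hD⟩ := IsRegularLocalRing.exists_ringKrullDim_eq S
  obtain ⟨rs, hlen, hmem, hreg⟩ := IsRegularLocalRing.exists_isWeaklyRegular_of_flat hD
  -- The terms of the complex need not be finitely generated; what counts is that a single sequence
  -- in S is weakly regular on every flat S-module, in particular on all the corners.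
  have hZ := RingTheory.Sequence.IsWeaklyRegular.of_shortExact_family
    (rs.map (algebraMap S (BranchedCover f n)))
    (fun j => corner a b (P (j + 1))) (fun j => corner a b (Z j))
    (fun j => cornerMap a b (Z (j + 1)).subtype) (fun j => cornerMap a b (d j).rangeRestrict)
    (fun j => cornerMap_injective (Z (j + 1)).injective_subtype)
    (fun j => cornerMap_exact hab fun x => by
      rw [Subtype.ext_iff]
      exact (hexact j x).trans (by simp [Z]))
    (fun j => cornerMap_surjective hab (d j).surjective_rangeRestrict)
    (fun j => isWeaklyRegular_corner hMt hab hreg (P (j + 1))) 0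
  have hfinZ : Module.Finite (RightEnd Mt) (Z 0) := Module.Finite.equiv e
  have : Module.Finite (BranchedCover f n) (Z 0) := Module.Finite.trans (RightEnd Mt) (Z 0)
  refine ⟨ModuleCat.of _ (corner a b (Z 0)), ?_, ⟨?_⟩⟩
  · rw [mcm_iff_depthGE (ringKrullDim_eq f n hD)]
    refine ⟨inferInstanceAs (Module.Finite _ (corner a b (Z 0))), _, ?_, ?_, hZ⟩
    · rw [List.length_map, hlen]
    · intro r hr
      obtain ⟨t, ht, rfl⟩ := List.mem_map.1 hr
      exact map_nonunit _ t (hmem t ht)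
  · have hbij : ∀ k l, k + 1 = l → Function.Bijective (toHomCorner (Z l) hab) := by
      rintro k _ rfl
      exact toHomCorner_bijective hab (v := (Z (k + 1)).subtype) (w := d k)
        (Z (k + 1)).injective_subtype fun x => (hexact k x).trans (by simp [Z])
    exact (e.trans (LinearEquiv.ofBijective _ (hbij (-1) 0 rfl))).toModuleIso

end Converse

end BranchedCover

lemma GP.of_linearEquiv {A : Type u} [Ring A] {X Y : ModuleCat.{u} A} (hY : GP A Y)
    (e : X ≃ₗ[A] Y) : GP A X := by
  obtain ⟨hfin, ⟨c⟩⟩ := hY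
  exact ⟨Module.Finite.equiv e.symm, ⟨{ c with iso := e.trans c.iso }⟩⟩

theorem mainTheorem3 {S : Type u} [CommRing S] [IsRegularLocalRing S]
    (f : IsLocalRing.maximalIdeal S) (hf : f ≠ 0) (n : ℕ) [NeZero n]
    (M : ModuleCat.{u} (Hypersurface f)) (hM : IsRepresentationGenerator M)
    (Mt : ModuleCat.{u} (BranchedCover f n))
    (hMt : IsFirstSyzygy
      ((ModuleCat.restrictScalars (BranchedCover.toHypersurface f n)).obj M) Mt) :
    (∃ hF : ∀ N : (MCM (BranchedCover f n)).FullSubcategory,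
        GP (RightEnd Mt) (((MCM (BranchedCover f n)).ι ⋙ homFunctor Mt).obj N),
      ((GP (RightEnd Mt)).lift
        ((MCM (BranchedCover f n)).ι ⋙ homFunctor Mt) hF).IsEquivalence) ∧
    (∀ X : ModuleCat.{u} (RightEnd Mt),
      GP (RightEnd Mt) X ↔
        ∃ N : ModuleCat.{u} (BranchedCover f n), MCM (BranchedCover f n) N ∧
          Nonempty (X ≅ (homFunctor Mt).obj N)) := by
  obtain ⟨P, i, p, _, _, hi, hip, hp⟩ := hMt
  obtain ⟨a, b, hab⟩ := BranchedCover.exists_syzygy_apply_eq_one hf hM hip hp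
  have hMt : MCM (BranchedCover f n) Mt := BranchedCover.mcm_syzygy hf hM hi hip hp
  have hgp : ∀ {N : ModuleCat.{u} (BranchedCover f n)}, MCM (BranchedCover f n) N →
      GP (RightEnd Mt) ((homFunctor Mt).obj N) := fun hN =>
    BranchedCover.gp_homFunctor_of_mcm hf hM hip hi hp hab hN
  refine ⟨⟨fun N => hgp N.property, ?_⟩, fun X => ⟨BranchedCover.exists_mcm_of_gp hMt hab, ?_⟩⟩
  · refine { faithful := ⟨fun {N N'} g h hgh => ?_⟩, full := ⟨fun {N N'} T => ?_⟩,
             essSurj := ⟨fun X => ?_⟩ }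
    · have h1 : (homFunctor Mt).map g.hom = (homFunctor Mt).map h.hom :=
        congrArg (fun T => T.hom) hgh
      exact InducedCategory.hom_ext (homFunctor_map_injective hab h1)
    · obtain ⟨g, hg⟩ := homFunctor_linearMap_eq hab T.hom.hom
      exact ⟨ObjectProperty.homMk g, InducedCategory.hom_ext (ModuleCat.hom_ext hg.symm)⟩
    · obtain ⟨N, hN, ⟨e⟩⟩ := BranchedCover.exists_mcm_of_gp hMt hab X.property
      exact ⟨⟨N, hN⟩, ⟨ObjectProperty.isoMk _ e.symm⟩⟩
  · rintro ⟨N, hN, ⟨e⟩⟩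
    exact (hgp hN).of_linearEquiv e.toLinearEquiv
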